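/- Let $k$ be a commutative ring (for example a field) and let $U_+$ be a Hopf algebra over $k$ that is free of finite rank as a module (finite-dimensional, if $k$ is a field). Let $U_-=U_+^{*}$ be the dual Hopf algebra with product dual to the opposite coproduct, $\langle ab,x\rangle=\langle a\otimes b,\Delta' x\rangle$ with $\Delta'=\tau\circ\Delta$ the opposite coproduct, and coproduct dual to the product of $U_+$. Let $U$ be Drinfeld's quantum double of $U_+$: a Hopf algebra that contains $U_-$ and $U_+$ as Hopf subalgebras, such that multiplication $U_-\otimes U_+\to U$ is bijective and the canonical element $R=\sum_i e^i\otimes e_i\in U_-\otimes U_+\subset U\otimes U$ (for dual bases $e^i$, $e_i$ of $U_-$, $U_+$) is a universal $R$-matrix: $R$ is invertible, $R\,\Delta(x)=\Delta'(x)R$, $(\Delta\otimes\mathrm{id})R=R_{13}R_{23}$, $(\mathrm{id}\otimes\Delta)R=R_{13}R_{12}$. Let $F=U^*$ be the dual Hopf algebra with pairing $\langle\cdot,\cdot\rangle:U\otimes F\to k$, and let $T\in U\otimes F$ be the canonical element. Let $D_H$ be the Heisenberg double: the module $F\otimes U$ with the algebra structure that extends those of $F$ and $U$ and satisfies $f\cdot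 x=f\otimes x$ and $x\cdot f=\sum f_{(1)}\langle x_{(1)},f_{(2)}\rangle\otimes x_{(2)}$ for $x\in U$, $f\in F$. Let $\phi$ be an algebra automorphism of $U$ with $(\phi\otimes\phi)(R)=R$, let $\phi^*:F\to F$, $\langle x,\phi^*(f)\rangle=\langle\phi(x),f\rangle$, be its pullback, and for $X$ in $U\otimes A$ write $X^\phi=\phi(X)=(\phi\otimes\mathrm{id})(X)$. Let $Y\in U\otimes U$ be a universal invertible twisted-invariant 2-tensor, that is, an invertible element with $$Y_{13}R^\phi_{12}Y_{23}R_{21}=R_{12}Y_{23}R^\phi_{21}Y_{13}\ \text{ in } U\otimes U\otimes U,\qquad Y_{12}T^\phi_{13}T_{23}=T_{13}T_{23}Y_{12}\ \text{ in } U\otimes U\otimes F,$$ $$Y_{13}T_{23}=T_{23}R_{21}Y_{13}R^\phi_{12}\ \text{ in } U\otimes U\otimes D_H .$$ Let $F_+=(U_+)^*$, regarded as a subspace of $F$ by extending $\ell\in F_+$ to the form $ax\mapsto\varepsilon(a)\ell(x)$ on $U$ ($a\in U_-$, $x\in U_+$), and let $Z\in U_+\otimes F_+\subset U\otimes F$ be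 the canonical element (the second factor of the factorization $T=\Lambda Z$, $\Lambda\in U_-\otimes F_-$). Put $$\widetilde T=\phi(Z)\,Y^{-1}Z^{-1}\in U\otimes D_H .$$ Let $h\in F$ be twisted cocommutative, $\Delta' h=(\phi^*\otimes\mathrm{id})(\Delta h)$, and let $\widetilde h=\langle\widetilde T,h\otimes\mathrm{id}\rangle\in D_H$ be its image under the map $f\mapsto\langle\widetilde T,f\otimes\mathrm{id}\rangle$ from $F$ to $D_H$. Then $Z$ is invertible in $U\otimes D_H$ (so that $\widetilde T$ is defined); there is an invertible $u\in U$ with $$u^{-1}=\sum_i\beta_i\,S^2(\alpha_i)\quad\text{for } R=\sum_i\alpha_i\otimes\beta_i,\qquad S^2(x)=u\,x\,u^{-1}\ \text{ for all } x\in U;$$ and $\widetilde h$ is a Casimir of $U\subset D_H$: it lies in $U$, commutes with every element of $U$, and is given by $$\widetilde h=\langle\widetilde T,h\otimes\mathrm{id}\rangle=\langle u_1^{-1}Y^{-1},h\otimes\mathrm{id}\rangle,\qquad u_1^{-1}=u^{-1}\otimes 1 .$$ -/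

import Mathlib

open scoped TensorProduct

noncomputable section

namespace TwistedHeisenberg

/-! ### Leg notation in threefold tensor products -/

section Legs

variable (k A B C : Type*) [CommRing k] [Ring A] [Algebra k A] [Ring B] [Algebra k B]
  [Ring C] [Algebra k C]

/-- `X ↦ X₁₂`, that is `a ⊗ b ↦ a ⊗ b ⊗ 1`. -/
def leg12 : A ⊗[k] B →ₐ[k] A ⊗[k] (B ⊗[k] C) :=
  Algebra.TensorProduct.map (AlgHom.id k A) Algebra.TensorProduct.includeLeft

/-- `X ↦ X₁₃`, that is `a ⊗ c ↦ a ⊗ 1 ⊗ c`. -/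
def leg13 : A ⊗[k] C →ₐ[k] A ⊗[k] (B ⊗[k] C) :=
  Algebra.TensorProduct.map (AlgHom.id k A) Algebra.TensorProduct.includeRight

/-- `X ↦ X₂₃`, that is `b ⊗ c ↦ 1 ⊗ b ⊗ c`. -/
def leg23 : B ⊗[k] C →ₐ[k] A ⊗[k] (B ⊗[k] C) :=
  Algebra.TensorProduct.includeRight

end Legs

/-- `X ↦ X₂₁`, that is `a ⊗ b ↦ b ⊗ a`. -/
def flip21 {k U : Type*} [CommRing k] [Ring U] [Algebra k U] (X : U ⊗[k] U) : U ⊗[k] U :=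
  TensorProduct.comm k U U X

/-- `X ↦ (φ ⊗ id) X`, written `X^φ`: apply `φ` to the first tensor factor. -/
def twistFirst {k U A : Type*} [CommRing k] [Ring U] [Algebra k U] [Ring A] [Algebra k A]
    (φ : U ≃ₐ[k] U) : U ⊗[k] A →ₐ[k] U ⊗[k] A :=
  Algebra.TensorProduct.map (φ : U →ₐ[k] U) (AlgHom.id k A)

/-- The canonical element `∑ i, e i ⊗ f i` of a perfect pairing, where `e` is a basis of `M` and
`f` the dual basis of `N`. (It does not depend on the basis.) -/
def canonicalElement {k M N : Type*} [CommRing k] [AddCommGroup M] [Module k M]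
    [AddCommGroup N] [Module k N] [Module.Free k M] [Module.Finite k M]
    (B : M →ₗ[k] N →ₗ[k] k) (hB : B.IsPerfPair) : M ⊗[k] N :=
  ∑ i, Module.Free.chooseBasis k M i ⊗ₜ[k]
    (LinearEquiv.ofBijective B.flip hB.bijective_right).symm
      ((Module.Free.chooseBasis k M).coord i)

/-! ### Universal R-matrices and the quantum double -/

/-- `R` is a universal R-matrix of the Hopf algebra `U`, i.e. `(U, R)` is quasitriangular. -/
structure IsUniversalRMatrix (k : Type*) {U : Type*} [CommRing k] [Ring U] [HopfAlgebra k U]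
    (R : U ⊗[k] U) : Prop where
  isUnit : IsUnit R
  intertwine : ∀ x : U,
    R * Coalgebra.comul (R := k) x = flip21 (Coalgebra.comul (R := k) x) * R
  comul_left : TensorProduct.assoc k U U U
      (TensorProduct.map (Coalgebra.comul (R := k)) LinearMap.id R) =
    leg13 k U U U R * leg23 k U U U R
  comul_right : TensorProduct.map LinearMap.id (Coalgebra.comul (R := k)) R =
    leg13 k U U U R * leg12 k U U U R

/-- The Hopf algebra `U` is (a model of) Drinfeld's quantum double of the Hopf algebra `Up`:
`Um` is the dual of `Up` whose product is dual to the opposite coproduct of `Up`; `U` contains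
`Um` and `Up` as Hopf subalgebras; multiplication `Um ⊗ Up → U` is bijective; and the image in
`U ⊗ U` of the canonical element of `Um ⊗ Up` is a universal R-matrix. -/
structure QuantumDouble (k Um Up U : Type*) [CommRing k]
    [Ring Um] [HopfAlgebra k Um] [Ring Up] [HopfAlgebra k Up] [Ring U] [HopfAlgebra k U]
    [Module.Free k Um] [Module.Finite k Um] where
  /-- the duality between `Um` and `Up` -/
  pair : Um →ₗ[k] Up →ₗ[k] k
  perfect : pair.IsPerfPair
  /-- `⟨a b, x⟩ = ⟨a ⊗ b, Δ' x⟩` -/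
  pair_mul : ∀ (a b : Um) (x : Up), pair (a * b) x =
    LinearMap.mul' k k (TensorProduct.map (pair b) (pair a) (Coalgebra.comul x))
  pair_one : ∀ x : Up, pair 1 x = Coalgebra.counit x
  /-- `⟨a, x y⟩ = ⟨Δ a, x ⊗ y⟩` -/
  mul_pair : ∀ (a : Um) (x y : Up), pair a (x * y) =
    LinearMap.mul' k k (TensorProduct.map (pair.flip x) (pair.flip y) (Coalgebra.comul a))
  one_pair : ∀ a : Um, pair a 1 = Coalgebra.counit a
  /-- the inclusion of `Um` -/
  inclMinus : Um →ₐc[k] U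
  /-- the inclusion of `Up` -/
  inclPlus : Up →ₐc[k] U
  bijective : Function.Bijective (LinearMap.mul' k U ∘ₗ
    TensorProduct.map inclMinus.toLinearMap inclPlus.toLinearMap)
  universal : IsUniversalRMatrix k
    (TensorProduct.map inclMinus.toLinearMap inclPlus.toLinearMap
      (canonicalElement pair perfect))

namespace QuantumDouble

variable {k Um Up U : Type*} [CommRing k]
  [Ring Um] [HopfAlgebra k Um] [Ring Up] [HopfAlgebra k Up] [Ring U] [HopfAlgebra k U]
  [Module.Free k Um] [Module.Finite k Um] (Q : QuantumDouble k Um Up U)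

/-- The universal R-matrix of the double, the canonical element of `Um ⊗ Up` in `U ⊗ U`. -/
def R : U ⊗[k] U :=
  TensorProduct.map Q.inclMinus.toLinearMap Q.inclPlus.toLinearMap
    (canonicalElement Q.pair Q.perfect)

/-- The element `(S² ⊗ id)(R)` with its two factors multiplied in the opposite order:
`∑ β i * S² (α i)` for `R = ∑ α i ⊗ β i`. -/
def uInv : U :=
  LinearMap.mul' k U (flip21 (TensorProduct.map
    (HopfAlgebra.antipode k (A := U) ∘ₗ HopfAlgebra.antipode k (A := U)) LinearMap.id Q.R))

/-- The projection `U → Up`, `a * x ↦ ε(a) x` for `a ∈ Um`, `x ∈ Up`. -/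
def projPlus : U →ₗ[k] Up :=
  (TensorProduct.lid k Up).toLinearMap ∘ₗ
    TensorProduct.map (Coalgebra.counit (R := k) (A := Um)) LinearMap.id ∘ₗ
      (LinearEquiv.ofBijective _ Q.bijective).symm.toLinearMap

end QuantumDouble

/-! ### The dual Hopf algebra -/

/-- The Hopf algebra `F` is the dual of the Hopf algebra `U` by a perfect pairing, for which the
product and coproduct of each are dual to the coproduct and product of the other. -/
structure HopfDuality (k U F : Type*) [CommRing k] [Ring U] [HopfAlgebra k U]
    [Ring F] [HopfAlgebra k F] where
  /-- the pairing -/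
  pair : U →ₗ[k] F →ₗ[k] k
  perfect : pair.IsPerfPair
  /-- `⟨x y, f⟩ = ⟨x ⊗ y, Δ f⟩` -/
  pair_mul : ∀ (x y : U) (f : F), pair (x * y) f =
    LinearMap.mul' k k (TensorProduct.map (pair x) (pair y) (Coalgebra.comul f))
  pair_one : ∀ f : F, pair 1 f = Coalgebra.counit f
  /-- `⟨x, f g⟩ = ⟨Δ x, f ⊗ g⟩` -/
  mul_pair : ∀ (x : U) (f g : F), pair x (f * g) =
    LinearMap.mul' k k (TensorProduct.map (pair.flip f) (pair.flip g) (Coalgebra.comul x))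
  one_pair : ∀ x : U, pair x 1 = Coalgebra.counit x

namespace HopfDuality

variable {k U F : Type*} [CommRing k] [Ring U] [HopfAlgebra k U] [Ring F] [HopfAlgebra k F]
  (P : HopfDuality k U F)

/-- The identification of `F` with the linear forms on `U`. -/
def equivDual : F ≃ₗ[k] Module.Dual k U :=
  LinearEquiv.ofBijective P.pair.flip P.perfect.bijective_right

/-- The universal `T`-matrix: the canonical element of `U ⊗ F`. -/
def T [Module.Free k U] [Module.Finite k U] : U ⊗[k] F :=
  canonicalElement P.pair P.perfect

/-- The pullback `φ^*` of `φ` to `F`: `⟨x, φ^* f⟩ = ⟨φ x, f⟩`. -/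
def pullback (φ : U ≃ₐ[k] U) : F →ₗ[k] F :=
  P.equivDual.symm.toLinearMap ∘ₗ φ.toLinearMap.dualMap ∘ₗ P.equivDual.toLinearMap

/-- `h` is twisted cocommutative: `Δ' h = (φ^* ⊗ id)(Δ h)`. -/
def IsTwistedCocommutative (φ : U ≃ₐ[k] U) (h : F) : Prop :=
  TensorProduct.comm k F F (Coalgebra.comul h) =
    TensorProduct.map (P.pullback φ) LinearMap.id (Coalgebra.comul h)

/-- Contraction of the first tensor factor with `f`: `X ↦ ⟨X, f ⊗ id⟩`. -/
def contract {A : Type*} [AddCommGroup A] [Module k A] (f : F) : U ⊗[k] A →ₗ[k] A :=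
  (TensorProduct.lid k A).toLinearMap ∘ₗ TensorProduct.map (P.pair.flip f) LinearMap.id

/-- The left action of `U` on `F`: `x ▷ f = f₍₁₎ ⟨x, f₍₂₎⟩`. -/
def act : U →ₗ[k] F →ₗ[k] F :=
  LinearMap.mk₂ k
    (fun x f => TensorProduct.rid k F (TensorProduct.map LinearMap.id (P.pair x)
      (Coalgebra.comul f)))
    (fun x y f => by simp [TensorProduct.map_add_right])
    (fun c x f => by simp [TensorProduct.map_smul_right])
    (fun x f g => by simp)
    (fun c x f => by simp)

lemma pair_ext {f g : F} (h : ∀ z, P.pair z f = P.pair z g) : f = g :=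
  P.perfect.bijective_right.injective (LinearMap.ext h)

lemma pair_act (z x : U) (f : F) : P.pair z (P.act x f) = P.pair (z * x) f := by
  rw [P.pair_mul]
  simp only [act, LinearMap.mk₂_apply]
  induction Coalgebra.comul (R := k) f with
  | zero => simp
  | tmul a b => simp [mul_comm]
  | add a b ha hb => simp only [map_add, ha, hb]

/-- The action as an algebra homomorphism. -/
def actHom : U →ₐ[k] Module.End k F :=
  AlgHom.ofLinearMap P.act
    (LinearMap.ext fun f => P.pair_ext fun z => by simp [pair_act])
    (fun x y => LinearMap.ext fun f => P.pair_ext fun z => by simp [pair_act, mul_assoc])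

@[simp] lemma actHom_apply (x : U) (f : F) : P.actHom x f = P.act x f := rfl

lemma act_one (x : U) : P.act x 1 = Coalgebra.counit (R := k) x • (1 : F) :=
  P.pair_ext fun z => by simp [pair_act, P.one_pair, mul_comm]

lemma act_mul (x : U) (f g : F) : P.act x (f * g) =
    LinearMap.mul' k F (TensorProduct.map (P.act.flip f) (P.act.flip g)
      (Coalgebra.comul x)) := by
  refine P.pair_ext fun z => ?_
  rw [pair_act, P.mul_pair, Bialgebra.comul_mul]
  induction Coalgebra.comul (R := k) x with
  | zero => simp
  | add a b ha hb => simp only [mul_add, map_add, ha, hb]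
  | tmul a b =>
    simp only [TensorProduct.map_tmul, LinearMap.mul'_apply, LinearMap.flip_apply, P.mul_pair]
    induction Coalgebra.comul (R := k) z with
    | zero => simp
    | add c d hc hd => simp only [add_mul, map_add, hc, hd]
    | tmul c d => simp [pair_act]

/-! ### The Heisenberg double -/

/-- Left multiplication by `f ∈ F` on `F ⊗ U`. -/
def mulF : F →ₐ[k] Module.End k (F ⊗[k] U) :=
  (Module.endTensorEndAlgHom (R := k) (S := k) (A := k) (M := F) (N := U)).comp
    (Algebra.TensorProduct.includeLeft.comp (Algebra.lmul k F))

/-- Left multiplication by `x ∈ U` on `F ⊗ U`: `x · (g ⊗ y) = ∑ (x₍₁₎ ▷ g) ⊗ x₍₂₎ y`. -/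
def mulU : U →ₐ[k] Module.End k (F ⊗[k] U) :=
  (Module.endTensorEndAlgHom (R := k) (S := k) (A := k) (M := F) (N := U)).comp
    ((Algebra.TensorProduct.map P.actHom (Algebra.lmul k U)).comp (Bialgebra.comulAlgHom k U))

/-- The product of the Heisenberg double: `(f ⊗ x) · d = f · (x · d)`. -/
def smashMul : F ⊗[k] U →ₗ[k] Module.End k (F ⊗[k] U) :=
  LinearMap.mul' k (Module.End k (F ⊗[k] U)) ∘ₗ
    TensorProduct.map (mulF (k := k) (U := U) (F := F)).toLinearMap P.mulU.toLinearMap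

lemma mulF_tmul (f g : F) (y : U) :
    mulF (k := k) f (g ⊗ₜ[k] y) = (f * g) ⊗ₜ[k] y := by
  simp only [mulF, AlgHom.comp_apply, Algebra.TensorProduct.includeLeft_apply]
  rw [Module.endTensorEndAlgHom_apply]
  simp

lemma mulU_tmul (x : U) (g : F) (y : U) : P.mulU x (g ⊗ₜ[k] y) =
    TensorProduct.map (P.act.flip g) (LinearMap.mulRight k y) (Coalgebra.comul x) := by
  simp only [mulU, AlgHom.comp_apply, Bialgebra.comulAlgHom_apply]
  induction Coalgebra.comul (R := k) x with
  | zero => simp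
  | add a b ha hb => simp only [map_add, LinearMap.add_apply, ha, hb]
  | tmul a b =>
    rw [Algebra.TensorProduct.map_tmul, Module.endTensorEndAlgHom_apply]
    simp

lemma smashMul_tmul (f : F) (x : U) :
    P.smashMul (f ⊗ₜ[k] x) = mulF (k := k) f * P.mulU x := by
  simp [smashMul]

lemma smashMul_mulF (f : F) (b : F ⊗[k] U) :
    P.smashMul (mulF (k := k) f b) = mulF (k := k) f * P.smashMul b := by
  induction b with
  | zero => simp
  | add a b ha hb => simp only [map_add, mul_add, ha, hb]
  | tmul g y => rw [mulF_tmul, smashMul_tmul, smashMul_tmul, map_mul, mul_assoc]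

lemma mulU_mul_mulF (x : U) (g : F) : P.mulU x * mulF (k := k) g =
    LinearMap.mul' k (Module.End k (F ⊗[k] U)) (TensorProduct.map
      ((mulF (k := k) (U := U) (F := F)).toLinearMap ∘ₗ P.act.flip g) P.mulU.toLinearMap
      (Coalgebra.comul x)) := by
  refine TensorProduct.ext' fun h z => ?_
  let Θ : U →ₗ[k] (U ⊗[k] U) →ₗ[k] F ⊗[k] U :=
    LinearMap.mk₂ k (fun a t => mulF (k := k) (P.act a g)
        (TensorProduct.map (P.act.flip h) (LinearMap.mulRight k z) t))
      (fun a b t => by simp) (fun c a t => by simp) (fun a s t => by simp)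
      (fun c a t => by simp)
  have hco := Coalgebra.coassoc_apply (R := k) x
  have h1 : (P.mulU x * mulF (k := k) (U := U) g : Module.End k (F ⊗[k] U)) (h ⊗ₜ[k] z) =
      TensorProduct.lift Θ (TensorProduct.assoc k U U U
        ((Coalgebra.comul (R := k)).rTensor U (Coalgebra.comul x))) := by
    rw [Module.End.mul_apply, mulF_tmul, mulU_tmul]
    induction Coalgebra.comul (R := k) x with
    | zero => simp
    | add a b ha hb => simp only [map_add, ha, hb]
    | tmul a b =>
      simp only [TensorProduct.map_tmul, LinearMap.flip_apply, act_mul, LinearMap.rTensor_tmul]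
      induction Coalgebra.comul (R := k) a with
      | zero => simp
      | add c d hc hd => simp only [map_add, TensorProduct.add_tmul, hc, hd]
      | tmul c d => simp [Θ, mulF_tmul]
  rw [h1, hco]
  induction Coalgebra.comul (R := k) x with
  | zero => simp
  | add a b ha hb => simp only [map_add, LinearMap.add_apply, ha, hb]
  | tmul a b =>
    simp [Θ, mulU_tmul]

lemma smashMul_mulU (x : U) (b : F ⊗[k] U) :
    P.smashMul (P.mulU x b) = P.mulU x * P.smashMul b := by
  induction b with
  | zero => simp
  | add a b ha hb => simp only [map_add, mul_add, ha, hb]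
  | tmul g y =>
    rw [mulU_tmul, smashMul_tmul, ← mul_assoc, mulU_mul_mulF]
    induction Coalgebra.comul (R := k) x with
    | zero => simp
    | add a b ha hb => simp only [map_add, add_mul, ha, hb]
    | tmul a b => simp [smashMul_tmul, mul_assoc]

lemma smashMul_assoc (a b : F ⊗[k] U) :
    P.smashMul (P.smashMul a b) = P.smashMul a * P.smashMul b := by
  induction a with
  | zero => simp
  | add a b ha hb => simp only [map_add, LinearMap.add_apply, add_mul, ha, hb]
  | tmul f x =>
    rw [smashMul_tmul, Module.End.mul_apply, smashMul_mulF, smashMul_mulU, mul_assoc]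

lemma mulU_one_tmul (x y : U) : P.mulU x ((1 : F) ⊗ₜ[k] y) = (1 : F) ⊗ₜ[k] (x * y) := by
  rw [mulU_tmul]
  conv_rhs => rw [← Coalgebra.sum_counit_smul (Coalgebra.Repr.arbitrary k x)]
  conv_lhs => rw [← (Coalgebra.Repr.arbitrary k x).eq]
  simp [act_one, Finset.sum_mul, TensorProduct.tmul_sum, TensorProduct.smul_tmul]

lemma smashMul_one_right (a : F ⊗[k] U) : P.smashMul a ((1 : F) ⊗ₜ[k] (1 : U)) = a := by
  induction a with
  | zero => simp
  | add a b ha hb => simp only [map_add, LinearMap.add_apply, ha, hb]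
  | tmul f x =>
    rw [smashMul_tmul, Module.End.mul_apply, mulU_one_tmul, mulF_tmul, mul_one, mul_one]

end HopfDuality

/-- The Heisenberg double of `F`: the module `F ⊗ U` with the product of the semidirect (smash)
product, `x · f = f₍₁₎ ⟨x₍₁₎, f₍₂₎⟩ ⊗ x₍₂₎`. -/
def HeisenbergDouble {k U F : Type*} [CommRing k] [Ring U] [HopfAlgebra k U] [Ring F]
    [HopfAlgebra k F] (_P : HopfDuality k U F) : Type _ :=
  F ⊗[k] U

namespace HeisenbergDouble

variable {k U F : Type*} [CommRing k] [Ring U] [HopfAlgebra k U] [Ring F] [HopfAlgebra k F]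
  (P : HopfDuality k U F)

instance : AddCommGroup (HeisenbergDouble P) :=
  inferInstanceAs (AddCommGroup (F ⊗[k] U))

instance : Module k (HeisenbergDouble P) :=
  inferInstanceAs (Module k (F ⊗[k] U))

instance : Ring (HeisenbergDouble P) where
  __ := (inferInstance : AddCommGroup (HeisenbergDouble P))
  mul a b := P.smashMul a b
  one := (1 : F) ⊗ₜ[k] (1 : U)
  left_distrib a b c := map_add (P.smashMul a) b c
  right_distrib a b c := LinearMap.congr_fun (map_add P.smashMul a b) c
  zero_mul a := LinearMap.congr_fun (map_zero P.smashMul) a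
  mul_zero a := map_zero (P.smashMul a)
  mul_assoc a b c := LinearMap.congr_fun (P.smashMul_assoc a b) c
  one_mul a := by
    change P.smashMul ((1 : F) ⊗ₜ[k] (1 : U)) a = a
    rw [HopfDuality.smashMul_tmul, map_one, map_one, mul_one]
    rfl
  mul_one a := P.smashMul_one_right a

instance : Algebra k (HeisenbergDouble P) :=
  Algebra.ofModule
    (fun c a b => LinearMap.congr_fun (map_smul P.smashMul c a) b)
    (fun c a b => map_smul (P.smashMul a) c b)

/-- The inclusion `F → D_H`, `f ↦ f ⊗ 1`. -/
def ofF : F →ₐ[k] HeisenbergDouble P :=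
  AlgHom.ofLinearMap ((TensorProduct.mk k F U).flip 1 : F →ₗ[k] F ⊗[k] U) rfl fun f g => by
    change (f * g) ⊗ₜ[k] (1 : U) = P.smashMul (f ⊗ₜ[k] 1) (g ⊗ₜ[k] 1)
    simp [HopfDuality.smashMul_tmul, HopfDuality.mulF_tmul]

/-- The inclusion `U → D_H`, `x ↦ 1 ⊗ x`. -/
def ofU : U →ₐ[k] HeisenbergDouble P :=
  AlgHom.ofLinearMap (TensorProduct.mk k F U 1 : U →ₗ[k] F ⊗[k] U) rfl fun x y => by
    change (1 : F) ⊗ₜ[k] (x * y) = P.smashMul (1 ⊗ₜ[k] x) (1 ⊗ₜ[k] y)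
    simp [HopfDuality.smashMul_tmul, HopfDuality.mulU_one_tmul]

/-- `id ⊗ (F → D_H)`. -/
def inF : U ⊗[k] F →ₐ[k] U ⊗[k] HeisenbergDouble P :=
  Algebra.TensorProduct.map (AlgHom.id k U) (ofF P)

/-- `id ⊗ (U → D_H)`. -/
def inU : U ⊗[k] U →ₐ[k] U ⊗[k] HeisenbergDouble P :=
  Algebra.TensorProduct.map (AlgHom.id k U) (ofU P)

end HeisenbergDouble

open HeisenbergDouble

section Twist

variable {k Um Up U F : Type*} [CommRing k]
  [Ring Um] [HopfAlgebra k Um] [Ring Up] [HopfAlgebra k Up] [Ring U] [HopfAlgebra k U]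
  [Ring F] [HopfAlgebra k F]
  [Module.Free k Um] [Module.Finite k Um]
  (Q : QuantumDouble k Um Up U) (P : HopfDuality k U F)

/-- `Y` is a universal twisted-invariant 2-tensor: it satisfies the twisted reflection equation,
twisted invariance, and the mixed relation with `T` in `U ⊗ U ⊗ D_H`. -/
structure IsTwistTensor [Module.Free k U] [Module.Finite k U] (φ : U ≃ₐ[k] U)
    (Y : U ⊗[k] U) : Prop where
  /-- `Y₁ R^φ₁₂ Y₂ R₂₁ = R₁₂ Y₂ R^φ₂₁ Y₁` -/
  reflection :
    leg13 k U U U Y * leg12 k U U U (twistFirst φ Q.R) * leg23 k U U U Y *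
        leg12 k U U U (flip21 Q.R) =
      leg12 k U U U Q.R * leg23 k U U U Y * leg12 k U U U (flip21 (twistFirst φ Q.R)) *
        leg13 k U U U Y
  /-- `Y₁₂ T^φ₁ T₂ = T₁ T₂ Y₁₂` -/
  invariant :
    leg12 k U U F Y * leg13 k U U F (twistFirst φ P.T) * leg23 k U U F P.T =
      leg13 k U U F P.T * leg23 k U U F P.T * leg12 k U U F Y
  /-- `Y₁ T₂ = T₂ R₂₁ Y₁ R^φ₁₂` -/
  mixed :
    leg13 k U U (HeisenbergDouble P) (inU P Y) * leg23 k U U (HeisenbergDouble P) (inF P P.T) =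
      leg23 k U U (HeisenbergDouble P) (inF P P.T) *
        leg12 k U U (HeisenbergDouble P) (flip21 Q.R) *
        leg13 k U U (HeisenbergDouble P) (inU P Y) *
        leg12 k U U (HeisenbergDouble P) (twistFirst φ Q.R)

/-- The inclusion of `F₊ = Up^*` in `F`: the form `ℓ` on `Up` becomes the form
`a * x ↦ ε(a) ℓ(x)` on `U`, where `a ∈ Um`, `x ∈ Up`. -/
def inclFPlus : Module.Dual k Up →ₗ[k] F :=
  P.equivDual.symm.toLinearMap ∘ₗ Q.projPlus.dualMap

/-- The factor `Z` of `T = Λ Z`: the canonical element of `Up ⊗ F₊`, in `U ⊗ F`. -/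
def Z [Module.Free k Up] [Module.Finite k Up] : U ⊗[k] F :=
  TensorProduct.map Q.inclPlus.toLinearMap (inclFPlus Q P)
    (canonicalElement (Module.Dual.eval k Up) LinearMap.IsPerfPair.dualEval)

/-- `T̃ = φ(Z) Y⁻¹ Z⁻¹ ∈ U ⊗ D_H`. -/
def tildeT [Module.Free k Up] [Module.Finite k Up] (φ : U ≃ₐ[k] U) (Y : (U ⊗[k] U)ˣ) :
    U ⊗[k] HeisenbergDouble P :=
  twistFirst φ (inF P (Z Q P)) * inU P (↑Y⁻¹ : U ⊗[k] U) * Ring.inverse (inF P (Z Q P))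

/-- The embedding `F → D_H`, `f ↦ ⟨T̃, f ⊗ id⟩`. -/
def tildeMap [Module.Free k Up] [Module.Finite k Up] (φ : U ≃ₐ[k] U) (Y : (U ⊗[k] U)ˣ)
    (f : F) : HeisenbergDouble P :=
  P.contract f (tildeT Q P φ Y)

end Twist

end TwistedHeisenberg

end

/-!
The pairing with `h` is a functional `τ` on `U`, and twisted cocommutativity says that it is a
twisted trace, `τ(y x) = τ(φ(x) y)`. The proof reduces every hypothesis to a statement about `U`.

* An element of `U ⊗ F` is the same as an endomorphism of `U` (`HopfDuality.toHom`), and products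
  become convolutions. The element `T` is the identity and `Z` is the projection `π : a x ↦ ε(a) x`
  onto `Up`. Both are morphisms of coalgebras, hence convolution invertible, with inverse
  `(S ⊗ id)` of the element (`HopfDuality.mul_antipode_of_comul`).
* Twisted invariance of `Y` says `Y (φ ⊗ id)Δ(x) = Δ(x) Y` (`HopfDuality.mul_twist_comul`). In
  `U ⊗ D_H` one has `x T = T Δ(x)`, so, `T` being invertible, the mixed relation says
  `(id ⊗ Δ)(Y) = R₂₁ Y₁₃ R^φ₁₂` (`IsTwistTensor.comul_right`).
* Drinfeld's element `u = Σ S(β) α` has inverse `Σ β S²(α)`, implements `S²`, and is fixed by every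
  algebra automorphism that fixes `R` (`IsUniversalRMatrix.map_drinfeldUnit`). In particular the
  antipode has the inverse `x ↦ u⁻¹ S(x) u`.

Centrality (`IsUniversalRMatrix.commute_contract`): put `W = Y⁻¹` and `c = (τ(u⁻¹ ·) ⊗ id)(W)`. From
`1 ⊗ x = Δ(x₍₂₎) (S⁻¹(x₍₁₎) ⊗ 1) = (S(x₍₁₎) ⊗ 1) Δ(x₍₂₎)`, the intertwining property of `W` turns
`c x` into `x c` as soon as `S⁻¹(a)` on the right may be traded for `φ(S(a))` on the left; this is
the twisted trace property together with `u S⁻¹(a) = S(a) u` and `φ(u) = u`.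

The formula for `⟨T̃, h ⊗ id⟩`: contract it with `v ∈ U`. Moving `φ(Z)` around the trace and
reordering in `D_H` gives `τ(y S(π(v₍₂₎ a)) π(v₍₁₎)) b`, where `y ⊗ a ⊗ b = (id ⊗ Δ)(W)`
(`evalDouble_contract`). This depends only on the `Up`-part of `v`
(`QuantumDouble.convProj_comul_mul`), so let `v ∈ Up`. Inserting
`(id ⊗ Δ)(W) = (R^φ₁₂)⁻¹ W₁₃ R₂₁⁻¹` leaves the sum `σ' S(π(v₍₂₎ ρ' σ)) v₍₁₎ ρ` over two copies
`ρ ⊗ ρ'` and `σ ⊗ σ'` of `R⁻¹`. The intertwining property of `R` gives `σ' S(π(w σ)) = S⁻¹(w)` for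
`w ∈ Up` (`QuantumDouble.foldProj_mul_RInv`), and the sum becomes
`S⁻¹(ρ') S⁻¹(v₍₂₎) v₍₁₎ ρ = ε(v) S⁻¹(ρ') ρ = ε(v) u⁻¹`.
-/

namespace TwistedHeisenberg

/-! ### Legs and cancellation of Sweedler factors -/

section Legs

variable {k A B C : Type*} [CommRing k] [Ring A] [Algebra k A] [Ring B] [Algebra k B]
  [Ring C] [Algebra k C]

@[simp] lemma leg12_tmul (a : A) (b : B) :
    leg12 k A B C (a ⊗ₜ[k] b) = a ⊗ₜ[k] (b ⊗ₜ[k] (1 : C)) := rfl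

@[simp] lemma leg13_tmul (a : A) (c : C) :
    leg13 k A B C (a ⊗ₜ[k] c) = a ⊗ₜ[k] ((1 : B) ⊗ₜ[k] c) := rfl

@[simp] lemma leg23_tmul (b : B) (c : C) :
    leg23 k A B C (b ⊗ₜ[k] c) = (1 : A) ⊗ₜ[k] (b ⊗ₜ[k] c) := rfl

end Legs

section Hopf

variable {k U : Type*} [CommRing k] [Ring U] [HopfAlgebra k U]

open Coalgebra HopfAlgebra TensorProduct

lemma lid_map_counit_comul (a : U) : TensorProduct.lid k k
    (TensorProduct.map (counit (R := k)) (counit (R := k)) (comul (R := k) a)) =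
      counit (R := k) a := by
  have h := congrArg (fun t => TensorProduct.lid k k (TensorProduct.map LinearMap.id
    (counit (R := k)) t)) (rTensor_counit_comul (R := k) a)
  rw [LinearMap.rTensor, TensorProduct.map_map, LinearMap.id_comp, LinearMap.comp_id] at h
  rw [h]; simp

/-- A linear map `β` with `β (x₍₁₎ ⊗ x₍₂₎) = ε(x)` cancels the first two Sweedler factors of
`x₍₁₎ ⊗ x₍₂₎ ⊗ x₍₃₎`. -/
lemma map_left_comul_comul (β : U ⊗[k] U →ₗ[k] U)
    (hβ : ∀ a : U, β (comul a) = counit (R := k) a • (1 : U)) (x : U) :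
    map β LinearMap.id ((TensorProduct.assoc k U U U).symm
      (comul.lTensor U (comul (R := k) x))) = (1 : U) ⊗ₜ[k] x := by
  rw [coassoc_symm_apply]
  have h := congrArg (map (LinearMap.toSpanSingleton k U 1) LinearMap.id)
    (rTensor_counit_comul (R := k) x)
  simp only [TensorProduct.map_tmul, LinearMap.toSpanSingleton_apply, one_smul, LinearMap.id_apply] at h
  rw [← h]
  induction comul (R := k) x with
  | zero => simp
  | add a b ha hb => simp only [map_add, ha, hb]
  | tmul a b => simp [hβ]

/-- A linear map `β` with `β (x₍₁₎ ⊗ x₍₂₎) = ε(x)` cancels the last two Sweedler factors of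
`x₍₁₎ ⊗ x₍₂₎ ⊗ x₍₃₎`. -/
lemma map_right_comul_comul (β : U ⊗[k] U →ₗ[k] U)
    (hβ : ∀ a : U, β (comul a) = counit (R := k) a • (1 : U)) (x : U) :
    map LinearMap.id β ((TensorProduct.assoc k U U U)
      (comul.rTensor U (comul (R := k) x))) = x ⊗ₜ[k] (1 : U) := by
  rw [coassoc_apply]
  have h := congrArg (map LinearMap.id (LinearMap.toSpanSingleton k U 1))
    (lTensor_counit_comul (R := k) x)
  simp only [TensorProduct.map_tmul, LinearMap.toSpanSingleton_apply, one_smul, LinearMap.id_apply] at h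
  rw [← h]
  induction comul (R := k) x with
  | zero => simp
  | add a b ha hb => simp only [map_add, ha, hb]
  | tmul a b => simp [hβ]

end Hopf

/-! ### The inverse of a universal R-matrix -/

namespace IsUniversalRMatrix

open Coalgebra HopfAlgebra TensorProduct Bialgebra

variable {k U : Type*} [CommRing k] [Ring U] [HopfAlgebra k U] {R : U ⊗[k] U}

/-- `(ε ⊗ id)(R) = 1` -/
lemma counit_left (hR : IsUniversalRMatrix k R) :
    Algebra.TensorProduct.lid k U
      (Algebra.TensorProduct.map (counitAlgHom k U) (AlgHom.id k U) R) = 1 := by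
  set r := Algebra.TensorProduct.lid k U
      (Algebra.TensorProduct.map (counitAlgHom k U) (AlgHom.id k U) R) with hr
  let E : U ⊗[k] (U ⊗[k] U) →ₐ[k] U ⊗[k] U :=
    (Algebra.TensorProduct.lid k (U ⊗[k] U)).toAlgHom.comp
      (Algebra.TensorProduct.map (counitAlgHom k U) (AlgHom.id k _))
  have h1 : ∀ X : U ⊗[k] U, E (TensorProduct.assoc k U U U
      (TensorProduct.map (comul (R := k)) LinearMap.id X)) = X := by
    intro X
    induction X with
    | zero => simp
    | add a b ha hb => simp only [map_add, ha, hb]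
    | tmul a b =>
      have h := congrArg (fun t => TensorProduct.lid k U t) (rTensor_counit_comul (R := k) a)
      simp only [TensorProduct.lid_tmul, one_smul] at h
      conv_rhs => rw [← h]
      simp only [TensorProduct.map_tmul, LinearMap.id_apply]
      induction comul (R := k) a with
      | zero => simp
      | add a b ha hb => simp only [map_add, ha, hb, TensorProduct.add_tmul]
      | tmul c d => simp [E, TensorProduct.smul_tmul']
  have h2 : ∀ X : U ⊗[k] U, E (leg13 k U U U X) = (1 : U) ⊗ₜ[k]
      Algebra.TensorProduct.lid k U
        (Algebra.TensorProduct.map (counitAlgHom k U) (AlgHom.id k U) X) := by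
    intro X
    induction X with
    | zero => simp
    | add a b ha hb => simp only [map_add, ha, hb, TensorProduct.tmul_add]
    | tmul a b => simp [E]
  have h3 : ∀ X : U ⊗[k] U, E (leg23 k U U U X) = X := by
    intro X
    induction X with
    | zero => simp
    | add a b ha hb => simp only [map_add, ha, hb]
    | tmul a b => simp [E]
  have h := congrArg E hR.comul_left
  rw [h1, map_mul, h2, h3, ← hr] at h
  have h4 : (1 : U) ⊗ₜ[k] r = 1 := hR.isUnit.mul_right_cancel (by rw [← h, one_mul])
  simpa using congrArg (fun X => Algebra.TensorProduct.lid k U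
      (Algebra.TensorProduct.map (counitAlgHom k U) (AlgHom.id k U) X)) h4

/-- `(id ⊗ ε)(R) = 1` -/
lemma counit_right (hR : IsUniversalRMatrix k R) :
    Algebra.TensorProduct.rid k k U
      (Algebra.TensorProduct.map (AlgHom.id k U) (counitAlgHom k U) R) = 1 := by
  set r := Algebra.TensorProduct.rid k k U
      (Algebra.TensorProduct.map (AlgHom.id k U) (counitAlgHom k U) R) with hr
  let E : U ⊗[k] (U ⊗[k] U) →ₐ[k] U ⊗[k] U :=
    Algebra.TensorProduct.map (AlgHom.id k U) ((Algebra.TensorProduct.rid k k U).toAlgHom.comp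
      (Algebra.TensorProduct.map (AlgHom.id k _) (counitAlgHom k U)))
  have h1 : ∀ X : U ⊗[k] U, E (TensorProduct.map LinearMap.id (comul (R := k)) X) = X := by
    intro X
    induction X with
    | zero => simp
    | add a b ha hb => simp only [map_add, ha, hb]
    | tmul a b =>
      have h := congrArg (fun t => TensorProduct.rid k U t) (lTensor_counit_comul (R := k) b)
      simp only [TensorProduct.rid_tmul, one_smul] at h
      conv_rhs => rw [← h]
      simp only [TensorProduct.map_tmul, LinearMap.id_apply]
      induction comul (R := k) b with
      | zero => simp
      | add a b ha hb => simp only [map_add, ha, hb, TensorProduct.tmul_add]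
      | tmul c d => simp [E]
  have h2 : ∀ X : U ⊗[k] U, E (leg13 k U U U X) =
      Algebra.TensorProduct.rid k k U
        (Algebra.TensorProduct.map (AlgHom.id k U) (counitAlgHom k U) X) ⊗ₜ[k] (1 : U) := by
    intro X
    induction X with
    | zero => simp
    | add a b ha hb => simp only [map_add, ha, hb, TensorProduct.add_tmul]
    | tmul a b => simp [E, TensorProduct.smul_tmul']
  have h3 : ∀ X : U ⊗[k] U, E (leg12 k U U U X) = X := by
    intro X
    induction X with
    | zero => simp
    | add a b ha hb => simp only [map_add, ha, hb]
    | tmul a b => simp [E]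
  have h := congrArg E hR.comul_right
  rw [h1, map_mul, h2, h3, ← hr] at h
  have h4 : r ⊗ₜ[k] (1 : U) = 1 := hR.isUnit.mul_right_cancel (by rw [← h, one_mul])
  simpa using congrArg (fun X => Algebra.TensorProduct.rid k k U
      (Algebra.TensorProduct.map (AlgHom.id k U) (counitAlgHom k U) X)) h4

lemma antipode_left_mul (hR : IsUniversalRMatrix k R) :
    map (antipode k) LinearMap.id R * R = 1 := by
  let E : U ⊗[k] (U ⊗[k] U) →ₗ[k] U ⊗[k] U :=
    map (LinearMap.mul' k U ∘ₗ map (antipode k) LinearMap.id) LinearMap.id ∘ₗ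
      (TensorProduct.assoc k U U U).symm.toLinearMap
  have h1 : ∀ X : U ⊗[k] U, E (TensorProduct.assoc k U U U
      (TensorProduct.map (comul (R := k)) LinearMap.id X)) =
      (1 : U) ⊗ₜ[k] Algebra.TensorProduct.lid k U
        (Algebra.TensorProduct.map (counitAlgHom k U) (AlgHom.id k U) X) := by
    intro X
    induction X with
    | zero => simp
    | add a b ha hb => simp only [map_add, ha, hb, TensorProduct.tmul_add]
    | tmul a b =>
      have := mul_antipode_rTensor_comul_apply (R := k) a
      simp only [LinearMap.rTensor] at this
      simp [E, this, Algebra.algebraMap_eq_smul_one, TensorProduct.smul_tmul']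
  have h2 : ∀ X Z : U ⊗[k] U, E (leg13 k U U U X * leg23 k U U U Z) =
      map (antipode k) LinearMap.id X * Z := by
    intro X Z
    induction X with
    | zero => simp
    | add a b ha hb => simp only [map_add, add_mul, ha, hb]
    | tmul a b =>
      induction Z with
      | zero => simp
      | add a b ha hb => simp only [map_add, mul_add, ha, hb]
      | tmul c d => simp [E]
  have h := congrArg E hR.comul_left
  rw [h1, h2, hR.counit_left] at h
  exact h.symm

lemma mul_antipode_left (hR : IsUniversalRMatrix k R) :
    R * map (antipode k) LinearMap.id R = 1 := by
  obtain ⟨r, hr⟩ := hR.isUnit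
  have h := hR.antipode_left_mul
  have h' : map (antipode k) LinearMap.id R = ↑r⁻¹ :=
    Units.eq_inv_of_mul_eq_one_right (by rw [hr]; exact h)
  rw [h', ← hr, r.mul_inv]

/-- `(S ⊗ S)(R) = R`, because `(id ⊗ S)(R⁻¹)` is inverse to `R⁻¹ = (S ⊗ id)(R)`. -/
lemma map_antipode_antipode (hR : IsUniversalRMatrix k R) :
    map (antipode k) (antipode k) R = R := by
  set I := map (antipode k) LinearMap.id R with hI
  have hIR : I * R = 1 := hR.antipode_left_mul
  have hRI : R * I = 1 := hR.mul_antipode_left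
  let D : U ⊗[k] U →ₐ[k] U ⊗[k] (U ⊗[k] U) :=
    Algebra.TensorProduct.map (AlgHom.id k U) (comulAlgHom k U)
  have hDR : D R = leg13 k U U U R * leg12 k U U U R := hR.comul_right
  have hDI : D I = leg12 k U U U I * leg13 k U U U I := by
    have h1 : D I * D R = 1 := by rw [← map_mul, hIR, map_one]
    have h2 : D R * (leg12 k U U U I * leg13 k U U U I) = 1 := by
      rw [hDR, mul_assoc, ← mul_assoc (leg12 k U U U R), ← map_mul, hRI, map_one, one_mul,
        ← map_mul, hRI, map_one]
    exact left_inv_eq_right_inv h1 h2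
  let E : U ⊗[k] (U ⊗[k] U) →ₗ[k] U ⊗[k] U :=
    map LinearMap.id (LinearMap.mul' k U ∘ₗ map (antipode k) LinearMap.id)
  have h1 : ∀ X : U ⊗[k] U, E (D X) =
      Algebra.TensorProduct.rid k k U
        (Algebra.TensorProduct.map (AlgHom.id k U) (counitAlgHom k U) X) ⊗ₜ[k] (1 : U) := by
    intro X
    induction X with
    | zero => simp
    | add a b ha hb => simp only [map_add, ha, hb, TensorProduct.add_tmul]
    | tmul a b =>
      have := mul_antipode_rTensor_comul_apply (R := k) b
      simp only [LinearMap.rTensor] at this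
      simp [E, D, this, Algebra.algebraMap_eq_smul_one, TensorProduct.smul_tmul']
  have h2 : ∀ X Z : U ⊗[k] U, E (leg12 k U U U X * leg13 k U U U Z) =
      map LinearMap.id (antipode k) X * Z := by
    intro X Z
    induction X with
    | zero => simp
    | add a b ha hb => simp only [map_add, add_mul, ha, hb]
    | tmul a b =>
      induction Z with
      | zero => simp
      | add a b ha hb => simp only [map_add, mul_add, ha, hb]
      | tmul c d => simp [E]
  have h3 : Algebra.TensorProduct.rid k k U
      (Algebra.TensorProduct.map (AlgHom.id k U) (counitAlgHom k U) I) = 1 := by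
    have h := congrArg (fun X => Algebra.TensorProduct.rid k k U
      (Algebra.TensorProduct.map (AlgHom.id k U) (counitAlgHom k U) X)) hRI
    simpa only [map_mul, hR.counit_right, one_mul, map_one] using h
  have h4 : map LinearMap.id (antipode k) I * I = 1 := by
    rw [← h2, ← hDI, h1, h3]; rfl
  have h5 : map LinearMap.id (antipode k) I = R := left_inv_eq_right_inv h4 hIR
  rw [hI, ← LinearMap.comp_apply, ← TensorProduct.map_comp] at h5
  exact h5

end IsUniversalRMatrix

/-! ### Drinfeld's element -/

namespace IsUniversalRMatrix

open Coalgebra HopfAlgebra TensorProduct Bialgebra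

variable {k U : Type*} [CommRing k] [Ring U] [HopfAlgebra k U] {R : U ⊗[k] U}

variable (k U) in
/-- The map `a ⊗ b ↦ S(b) a`, whose value at `R` is Drinfeld's element `u`. -/
noncomputable def antipodeMul : U ⊗[k] U →ₗ[k] U :=
  LinearMap.mul' k U ∘ₗ map (antipode k) LinearMap.id ∘ₗ (TensorProduct.comm k U U).toLinearMap

@[simp] lemma antipodeMul_tmul (a b : U) :
    antipodeMul k U (a ⊗ₜ[k] b) = antipode k b * a := rfl

variable (k U) in
/-- The map `a ⊗ b ↦ b S²(a)`, whose value at `R` is the inverse of Drinfeld's element. -/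
noncomputable def mulAntipodeSq : U ⊗[k] U →ₗ[k] U :=
  LinearMap.mul' k U ∘ₗ map LinearMap.id (antipode k ∘ₗ antipode k) ∘ₗ
    (TensorProduct.comm k U U).toLinearMap

@[simp] lemma mulAntipodeSq_tmul (a b : U) :
    mulAntipodeSq k U (a ⊗ₜ[k] b) = b * antipode k (antipode k a) := rfl

/-- The map `a ⊗ b ↦ b u a`. -/
noncomputable def sandwich (u : U) : U ⊗[k] U →ₗ[k] U :=
  LinearMap.mul' k U ∘ₗ map (LinearMap.mulRight k u) LinearMap.id ∘ₗ
    (TensorProduct.comm k U U).toLinearMap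

@[simp] lemma sandwich_tmul (u a b : U) : sandwich (k := k) u (a ⊗ₜ[k] b) = b * u * a := rfl

lemma antipodeMul_mul_tmul (X : U ⊗[k] U) (a b : U) :
    antipodeMul k U (X * a ⊗ₜ[k] b) = antipode k b * antipodeMul k U X * a := by
  induction X with
  | zero => simp
  | add x y hx hy => simp only [add_mul, map_add, mul_add, hx, hy]
  | tmul c d => simp [antipode_mul_antidistrib, mul_assoc]

lemma antipodeMul_flip_comul_mul (x : U) (X : U ⊗[k] U) :
    antipodeMul k U (flip21 (comul (R := k) x) * X) =
      counit (R := k) x • antipodeMul k U X := by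
  induction X with
  | zero => simp
  | add x y hx hy => simp only [mul_add, map_add, smul_add, hx, hy]
  | tmul c d =>
    have h : ∀ t : U ⊗[k] U, antipodeMul k U (flip21 t * c ⊗ₜ[k] d) =
        antipode k d * LinearMap.mul' k U ((antipode k).rTensor U t) * c := by
      intro t
      induction t with
      | zero => simp [flip21]
      | add x y hx hy => simp only [flip21, add_mul, map_add, mul_add] at hx hy ⊢; simp only [hx, hy]
      | tmul a b => simp [flip21, antipode_mul_antidistrib, mul_assoc]
    rw [h, mul_antipode_rTensor_comul_apply]
    simp [Algebra.algebraMap_eq_smul_one]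

/-- Conjugation by `u` is the square of the antipode. -/
lemma antipode_antipode_mul (hR : IsUniversalRMatrix k R) (x : U) :
    antipode k (antipode k x) * antipodeMul k U R = antipodeMul k U R * x := by
  set u := antipodeMul k U R with hu
  -- `Σ S(x₍₂₎) u x₍₁₎ = ε(x) u`, by applying `a ⊗ b ↦ S(b) a` to `R Δ(x) = Δ'(x) R`
  have h1 : ∀ x : U, sandwich u (map LinearMap.id (antipode k) (comul (R := k) x)) =
      counit (R := k) x • u := by
    intro x
    rw [hu, ← antipodeMul_flip_comul_mul, ← hR.intertwine, ← hu]
    induction comul (R := k) x with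
    | zero => simp
    | add a b ha hb => simp only [mul_add, map_add, ha, hb]
    | tmul a b => rw [antipodeMul_mul_tmul]; rfl
  let E : U ⊗[k] U →ₗ[k] U := LinearMap.mul' k U ∘ₗ
    map (antipode k ∘ₗ antipode k) LinearMap.id ∘ₗ (TensorProduct.comm k U U).toLinearMap
  let Ψ : U ⊗[k] (U ⊗[k] U) →ₗ[k] U :=
    E ∘ₗ map (sandwich u ∘ₗ map LinearMap.id (antipode k)) LinearMap.id ∘ₗ
      (TensorProduct.assoc k U U U).symm.toLinearMap
  have h2 : Ψ (comul.lTensor U (comul (R := k) x)) = antipode k (antipode k x) * u := by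
    simp only [Ψ, LinearMap.comp_apply, LinearEquiv.coe_coe, coassoc_symm_apply]
    have h3 : antipode k (antipode k x) * u =
      E (map (LinearMap.toSpanSingleton k U u) LinearMap.id ((1 : k) ⊗ₜ[k] x)) := by simp [E]
    rw [h3, ← rTensor_counit_comul (R := k) x]
    congr 1
    induction comul (R := k) x with
    | zero => simp
    | add a b ha hb => simp only [map_add, ha, hb]
    | tmul a b => simp [h1]
  have h4 : Ψ (comul.lTensor U (comul (R := k) x)) = u * x := by
    have h3 : u * x = LinearMap.mul' k U (map (LinearMap.toSpanSingleton k U u) LinearMap.id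
      (TensorProduct.comm k U k (x ⊗ₜ[k] (1 : k)))) := by simp
    rw [h3, ← lTensor_counit_comul (R := k) x]
    induction comul (R := k) x with
    | zero => simp
    | add a b ha hb => simp only [map_add, ha, hb]
    | tmul a b =>
      have h5 : ∀ t : U ⊗[k] U, Ψ (a ⊗ₜ[k] t) =
          antipode k (LinearMap.mul' k U ((antipode k).lTensor U t)) * u * a := by
        intro t
        induction t with
        | zero => simp
        | add x y hx hy => simp only [map_add, TensorProduct.tmul_add, add_mul, hx, hy]
        | tmul c d => simp [Ψ, E, antipode_mul_antidistrib, mul_assoc]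
      rw [LinearMap.lTensor_tmul, h5, mul_antipode_lTensor_comul_apply]
      simp [Algebra.algebraMap_eq_smul_one, antipode_one]
  rw [← h2, h4]

lemma antipodeMul_one : antipodeMul k U 1 = 1 := by
  simp [Algebra.TensorProduct.one_def, antipode_one]

lemma antipodeMul_mul (X Z : U ⊗[k] U) :
    antipodeMul k U (X * Z) =
      sandwich (antipodeMul k U X) (map LinearMap.id (antipode k) Z) := by
  induction Z with
  | zero => simp
  | add x y hx hy => simp only [mul_add, map_add, hx, hy]
  | tmul c d => rw [antipodeMul_mul_tmul]; simp

/-- `Σ β u α = 1`: this is `a ⊗ b ↦ S(b) a` applied to `R R⁻¹ = 1`, since `(S ⊗ S)(R) = R`. -/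
lemma sandwich_self (hR : IsUniversalRMatrix k R) : sandwich (antipodeMul k U R) R = 1 := by
  have h := antipodeMul_mul R (map (antipode k) LinearMap.id R)
  rw [hR.mul_antipode_left, antipodeMul_one, TensorProduct.map_map,
    LinearMap.id_comp, LinearMap.comp_id, hR.map_antipode_antipode] at h
  exact h.symm

/-- Drinfeld's element `u = Σ S(β) α`, a unit with inverse `Σ β S²(α)`. -/
noncomputable def drinfeldUnit (hR : IsUniversalRMatrix k R) : Uˣ where
  val := antipodeMul k U R
  inv := mulAntipodeSq k U R
  val_inv := by
    -- `u β = S²(β) u`, and `S² ⊗ S²` fixes `R`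
    have h1 : ∀ X : U ⊗[k] U, antipodeMul k U R * mulAntipodeSq k U X =
        sandwich (antipodeMul k U R)
          (map (antipode k) (antipode k) (map (antipode k) (antipode k) X)) := by
      intro X
      induction X with
      | zero => simp
      | add x y hx hy => simp only [mul_add, map_add, hx, hy]
      | tmul a b =>
        rw [mulAntipodeSq_tmul, ← mul_assoc, ← hR.antipode_antipode_mul]
        simp
    rw [h1, hR.map_antipode_antipode, hR.map_antipode_antipode, hR.sandwich_self]
  inv_val := by
    -- `S²(α) u = u α`
    have h1 : ∀ X : U ⊗[k] U, mulAntipodeSq k U X * antipodeMul k U R =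
        sandwich (antipodeMul k U R) X := by
      intro X
      induction X with
      | zero => simp
      | add x y hx hy => simp only [add_mul, map_add, hx, hy]
      | tmul a b => rw [mulAntipodeSq_tmul, mul_assoc, hR.antipode_antipode_mul]; simp [mul_assoc]
    rw [h1, hR.sandwich_self]

lemma antipode_antipode (hR : IsUniversalRMatrix k R) (x : U) :
    antipode k (antipode k x) = ↑hR.drinfeldUnit * x * ↑hR.drinfeldUnit⁻¹ := by
  rw [Units.eq_mul_inv_iff_mul_eq]
  exact hR.antipode_antipode_mul x

/-- An algebra automorphism that fixes `R` fixes Drinfeld's element: `(id ⊗ S)(R)` is the inverse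
of `R` in `U ⊗ Uᵒᵖ`, so the automorphism fixes it as well. -/
lemma map_drinfeldUnit (hR : IsUniversalRMatrix k R) (φ : U ≃ₐ[k] U)
    (hφ : Algebra.TensorProduct.map (φ : U →ₐ[k] U) (φ : U →ₐ[k] U) R = R) :
    φ (hR.drinfeldUnit : U) = hR.drinfeldUnit := by
  let o : U →ₗ[k] Uᵐᵒᵖ := (MulOpposite.opLinearEquiv k).toLinearMap
  set Ro : U ⊗[k] Uᵐᵒᵖ := map LinearMap.id o R with hRo
  set J : U ⊗[k] Uᵐᵒᵖ := map LinearMap.id (o ∘ₗ antipode k) R with hJ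
  let D : U ⊗[k] U →ₗ[k] U ⊗[k] (U ⊗[k] U) := map LinearMap.id (comul (R := k))
  have hD : D R = leg13 k U U U R * leg12 k U U U R := hR.comul_right
  -- `β` is `S(a) b` or `a S(b)`; the two choices give the two sides of the inverse
  have key : ∀ β : U ⊗[k] U →ₗ[k] U, (∀ a : U, β (comul a) = counit (R := k) a • (1 : U)) →
      map LinearMap.id (o ∘ₗ β) (leg13 k U U U R * leg12 k U U U R) = 1 := by
    intro β hβ
    rw [← hD]
    have h : ∀ X, map LinearMap.id (o ∘ₗ β) (D X) = (Algebra.TensorProduct.rid k k U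
      (Algebra.TensorProduct.map (AlgHom.id k U) (counitAlgHom k U) X)) ⊗ₜ[k] (1 : Uᵐᵒᵖ) := by
      intro X
      induction X with
      | zero => simp
      | add x y hx hy => simp only [map_add, TensorProduct.add_tmul, hx, hy]
      | tmul a b => simp [D, hβ, o, TensorProduct.smul_tmul']
    rw [h, hR.counit_right]; rfl
  have h1 : Ro * J = 1 := by
    rw [← key (LinearMap.mul' k U ∘ₗ (antipode k).rTensor U) fun a => by
      simp [mul_antipode_rTensor_comul_apply, Algebra.algebraMap_eq_smul_one]]
    rw [hRo, hJ]
    generalize R = X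
    suffices h : ∀ X Z : U ⊗[k] U,
        map LinearMap.id o X * map LinearMap.id (o ∘ₗ antipode k) Z =
        map LinearMap.id (o ∘ₗ (LinearMap.mul' k U ∘ₗ (antipode k).rTensor U))
          (leg13 k U U U X * leg12 k U U U Z) from h X X
    intro X Z
    induction X with
    | zero => simp
    | add x y hx hy => simp only [map_add, add_mul, hx, hy]
    | tmul a b =>
      induction Z with
      | zero => simp
      | add x y hx hy => simp only [map_add, mul_add, hx, hy]
      | tmul c d => simp [o]
  have h2 : J * Ro = 1 := by
    rw [← key (LinearMap.mul' k U ∘ₗ (antipode k).lTensor U) fun a => by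
      simp [mul_antipode_lTensor_comul_apply, Algebra.algebraMap_eq_smul_one]]
    rw [hRo, hJ]
    generalize R = X
    suffices h : ∀ X Z : U ⊗[k] U,
        map LinearMap.id (o ∘ₗ antipode k) X * map LinearMap.id o Z =
        map LinearMap.id (o ∘ₗ (LinearMap.mul' k U ∘ₗ (antipode k).lTensor U))
          (leg13 k U U U X * leg12 k U U U Z) from h X X
    intro X Z
    induction X with
    | zero => simp
    | add x y hx hy => simp only [map_add, add_mul, hx, hy]
    | tmul a b =>
      induction Z with
      | zero => simp
      | add x y hx hy => simp only [map_add, mul_add, hx, hy]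
      | tmul c d => simp [o]
  let Φ : U ⊗[k] Uᵐᵒᵖ →ₐ[k] U ⊗[k] Uᵐᵒᵖ :=
    Algebra.TensorProduct.map (φ : U →ₐ[k] U) (AlgHom.op (φ : U →ₐ[k] U))
  have hΦR : Φ Ro = Ro := by
    rw [hRo]
    conv_rhs => rw [← hφ]
    generalize R = X
    induction X with
    | zero => simp
    | add x y hx hy => simp only [map_add, hx, hy]
    | tmul a b => simp [Φ, o]
  have hΦJ : Φ J = J := by
    refine left_inv_eq_right_inv (a := Ro) ?_ h1
    conv_lhs => rw [← hΦR]
    rw [← map_mul, h2, map_one]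
  let N : U ⊗[k] Uᵐᵒᵖ →ₗ[k] U := LinearMap.mul' k U ∘ₗ
    map (MulOpposite.opLinearEquiv k).symm.toLinearMap LinearMap.id ∘ₗ
      (TensorProduct.comm k U Uᵐᵒᵖ).toLinearMap
  have hN : ∀ X, N (Φ X) = φ (N X) := by
    intro X
    induction X with
    | zero => simp
    | add x y hx hy => simp only [map_add, hx, hy]
    | tmul a b => simp [Φ, N]
  have hu : (hR.drinfeldUnit : U) = N J := by
    change antipodeMul k U R = _
    rw [hJ]
    generalize R = X
    induction X with
    | zero => simp
    | add x y hx hy => simp only [map_add, hx, hy]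
    | tmul a b => simp [N, o]
  rw [hu, ← hN, hΦJ]

lemma map_drinfeldUnit_inv (hR : IsUniversalRMatrix k R) (φ : U ≃ₐ[k] U)
    (hφ : Algebra.TensorProduct.map (φ : U →ₐ[k] U) (φ : U →ₐ[k] U) R = R) :
    φ (↑hR.drinfeldUnit⁻¹ : U) = ↑hR.drinfeldUnit⁻¹ := by
  refine left_inv_eq_right_inv (a := (hR.drinfeldUnit : U)) ?_ (Units.mul_inv _)
  conv_lhs => rw [← hR.map_drinfeldUnit φ hφ]
  rw [← map_mul, Units.inv_mul, map_one]

end IsUniversalRMatrix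

/-! ### The inverse antipode and central elements from twisted traces -/

namespace IsUniversalRMatrix

open Coalgebra HopfAlgebra TensorProduct Bialgebra

variable {k U : Type*} [CommRing k] [Ring U] [HopfAlgebra k U] {R : U ⊗[k] U}

/-- The inverse of the antipode, in the form `x ↦ u⁻¹ S(x) u`. -/
noncomputable def antipodeInv (hR : IsUniversalRMatrix k R) : U →ₗ[k] U :=
  LinearMap.mulLeft k (↑hR.drinfeldUnit⁻¹ : U) ∘ₗ LinearMap.mulRight k (hR.drinfeldUnit : U) ∘ₗ
    antipode k

lemma antipodeInv_apply (hR : IsUniversalRMatrix k R) (x : U) :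
    hR.antipodeInv x = ↑hR.drinfeldUnit⁻¹ * (antipode k x * hR.drinfeldUnit) := rfl

lemma antipodeInv_mul (hR : IsUniversalRMatrix k R) (x y : U) :
    hR.antipodeInv (x * y) = hR.antipodeInv y * hR.antipodeInv x := by
  simp [antipodeInv_apply, antipode_mul_antidistrib, mul_assoc]

/-- `u⁻¹ S²(x) = x u⁻¹` -/
lemma inv_mul_antipode_antipode (hR : IsUniversalRMatrix k R) (x : U) :
    ↑hR.drinfeldUnit⁻¹ * antipode k (antipode k x) = x * ↑hR.drinfeldUnit⁻¹ := by
  rw [hR.antipode_antipode, ← mul_assoc, ← mul_assoc, Units.inv_mul, one_mul]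

variable (k U) in
/-- The map `a ⊗ b ↦ b a`. -/
noncomputable def mulOp : U ⊗[k] U →ₗ[k] U :=
  LinearMap.mul' k U ∘ₗ (TensorProduct.comm k U U).toLinearMap

@[simp] lemma mulOp_tmul (a b : U) : mulOp k U (a ⊗ₜ[k] b) = b * a := rfl

/-- `S⁻¹(x₍₂₎) x₍₁₎ = ε(x)` -/
lemma antipodeInv_mul_comul (hR : IsUniversalRMatrix k R) (x : U) :
    mulOp k U (map LinearMap.id hR.antipodeInv (comul (R := k) x)) =
      counit (R := k) x • (1 : U) := by
  have h : ∀ t : U ⊗[k] U, mulOp k U (map LinearMap.id hR.antipodeInv t) =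
      ↑hR.drinfeldUnit⁻¹ * antipode k (LinearMap.mul' k U ((antipode k).rTensor U t)) *
        hR.drinfeldUnit := by
    intro t
    induction t with
    | zero => simp
    | add a b ha hb => simp only [map_add, mul_add, add_mul, ha, hb]
    | tmul a b =>
      simp only [TensorProduct.map_tmul, mulOp_tmul, LinearMap.id_apply, antipodeInv_apply,
        LinearMap.rTensor_tmul, LinearMap.mul'_apply, antipode_mul_antidistrib,
        hR.antipode_antipode]
      simp [mul_assoc]
  rw [h, mul_antipode_rTensor_comul_apply]
  simp [Algebra.algebraMap_eq_smul_one, antipode_one]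

/-- `x₍₂₎ S⁻¹(x₍₁₎) = ε(x)` -/
lemma mul_antipodeInv_comul (hR : IsUniversalRMatrix k R) (x : U) :
    mulOp k U (map hR.antipodeInv LinearMap.id (comul (R := k) x)) =
      counit (R := k) x • (1 : U) := by
  have h : ∀ t : U ⊗[k] U, mulOp k U (map hR.antipodeInv LinearMap.id t) =
      ↑hR.drinfeldUnit⁻¹ * antipode k (LinearMap.mul' k U ((antipode k).lTensor U t)) *
        hR.drinfeldUnit := by
    intro t
    induction t with
    | zero => simp
    | add a b ha hb => simp only [map_add, mul_add, add_mul, ha, hb]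
    | tmul a b =>
      simp only [TensorProduct.map_tmul, mulOp_tmul, LinearMap.id_apply, antipodeInv_apply,
        LinearMap.lTensor_tmul, LinearMap.mul'_apply, antipode_mul_antidistrib]
      rw [← mul_assoc, ← hR.inv_mul_antipode_antipode]
      simp [mul_assoc]
  rw [h, mul_antipode_lTensor_comul_apply]
  simp [Algebra.algebraMap_eq_smul_one, antipode_one]

/-- `S⁻¹(ρ') ρ = u⁻¹` for `R⁻¹ = (S ⊗ id)(R) = ρ ⊗ ρ'` -/
lemma mulOp_antipodeInv_inv (hR : IsUniversalRMatrix k R) :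
    mulOp k U (map LinearMap.id hR.antipodeInv (map (antipode k) LinearMap.id R)) =
      ↑hR.drinfeldUnit⁻¹ := by
  have h : ∀ X : U ⊗[k] U, mulOp k U (map LinearMap.id hR.antipodeInv
      (map (antipode k) LinearMap.id X)) = ↑hR.drinfeldUnit⁻¹ *
        mulAntipodeSq k U (map (antipode k) (antipode k) X) * hR.drinfeldUnit := by
    intro X
    induction X with
    | zero => simp
    | add a b ha hb => simp only [map_add, mul_add, add_mul, ha, hb]
    | tmul a b =>
      simp only [TensorProduct.map_tmul, mulOp_tmul, LinearMap.id_apply, antipodeInv_apply, mulAntipodeSq_tmul]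
      rw [hR.antipode_antipode (antipode k a)]
      simp [mul_assoc]
  rw [h, hR.map_antipode_antipode]
  change ↑hR.drinfeldUnit⁻¹ * ↑hR.drinfeldUnit⁻¹ * (hR.drinfeldUnit : U) = _
  simp

/-- If `τ` is a twisted trace, `τ(y x) = τ(φ(x) y)`, and `W` intertwines `Δ` with `(φ ⊗ id) ∘ Δ`,
then `(τ(u⁻¹ ·) ⊗ id)(W)` is central. -/
lemma commute_contract (hR : IsUniversalRMatrix k R) (φ : U ≃ₐ[k] U)
    (hφ : Algebra.TensorProduct.map (φ : U →ₐ[k] U) (φ : U →ₐ[k] U) R = R)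
    (τ : U →ₗ[k] k) (hτ : ∀ x y : U, τ (y * x) = τ (φ x * y)) (W : U ⊗[k] U)
    (hW : ∀ x : U, W * comul (R := k) x = twistFirst φ (comul (R := k) x) * W) (x : U) :
    Commute (TensorProduct.lid k U (map τ LinearMap.id
      (((↑hR.drinfeldUnit⁻¹ : U) ⊗ₜ[k] (1 : U)) * W))) x := by
  let χ : U ⊗[k] U →ₗ[k] U := (TensorProduct.lid k U).toLinearMap ∘ₗ map τ LinearMap.id ∘ₗ
    LinearMap.mulLeft k ((↑hR.drinfeldUnit⁻¹ : U) ⊗ₜ[k] (1 : U))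
  have hφu := hR.map_drinfeldUnit_inv φ hφ
  -- moving `S⁻¹(a)` around the twisted trace turns it into `φ(S(a))`
  have h1 : ∀ (a : U) (X : U ⊗[k] U), χ (X * (hR.antipodeInv a ⊗ₜ[k] (1 : U))) =
      χ ((φ (antipode k a) ⊗ₜ[k] (1 : U)) * X) := by
    intro a X
    induction X with
    | zero => simp
    | add a b ha hb => simp only [map_add, mul_add, add_mul, ha, hb]
    | tmul y y' =>
      simp only [χ, LinearMap.comp_apply, LinearMap.mulLeft_apply,
        Algebra.TensorProduct.tmul_mul_tmul, TensorProduct.map_tmul, LinearEquiv.coe_coe, TensorProduct.lid_tmul]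
      rw [← mul_assoc, hτ, antipodeInv_apply, map_mul φ, map_mul φ, hφu, hR.map_drinfeldUnit φ hφ]
      simp [mul_assoc]
  let incl : U →ₗ[k] U ⊗[k] U := (TensorProduct.mk k U U).flip 1
  have h2 : (1 : U) ⊗ₜ[k] x = LinearMap.mul' k (U ⊗[k] U)
      (TensorProduct.comm k _ _ (map (incl ∘ₗ hR.antipodeInv) (comul (R := k))
        (comul (R := k) x))) := by
    rw [← map_left_comul_comul (mulOp k U ∘ₗ map hR.antipodeInv LinearMap.id)
      hR.mul_antipodeInv_comul]
    induction comul (R := k) x with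
    | zero => simp
    | add a b ha hb => simp only [map_add, ha, hb]
    | tmul a b =>
      simp only [LinearMap.lTensor_tmul, TensorProduct.map_tmul, TensorProduct.comm_tmul]
      induction comul (R := k) b with
      | zero => simp
      | add a b ha hb => simp only [map_add, tmul_add, add_tmul, ha, hb]
      | tmul c d => simp [incl]
  have h3 : (1 : U) ⊗ₜ[k] x = LinearMap.mul' k (U ⊗[k] U)
      (map (incl ∘ₗ antipode k) (comul (R := k)) (comul (R := k) x)) := by
    rw [← map_left_comul_comul (LinearMap.mul' k U ∘ₗ (antipode k).rTensor U) fun a => by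
      simp [mul_antipode_rTensor_comul_apply, Algebra.algebraMap_eq_smul_one]]
    induction comul (R := k) x with
    | zero => simp
    | add a b ha hb => simp only [map_add, ha, hb]
    | tmul a b =>
      simp only [LinearMap.lTensor_tmul, TensorProduct.map_tmul]
      induction comul (R := k) b with
      | zero => simp
      | add a b ha hb => simp only [map_add, tmul_add, ha, hb]
      | tmul c d => simp [incl]
  have h4 : χ (W * (1 : U) ⊗ₜ[k] x) = χ ((1 : U) ⊗ₜ[k] x * W) := by
    have h5 : χ (W * (1 : U) ⊗ₜ[k] x) =
        χ (twistFirst φ ((1 : U) ⊗ₜ[k] x) * W) := by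
      conv_lhs => rw [h2]
      conv_rhs => rw [h3]
      induction comul (R := k) x with
      | zero => simp
      | add a b ha hb => simp only [map_add, mul_add, add_mul, ha, hb]
      | tmul a b =>
        simp only [TensorProduct.map_tmul, TensorProduct.comm_tmul, LinearMap.mul'_apply, LinearMap.comp_apply, incl,
          LinearMap.flip_apply, mk_apply, map_mul]
        rw [← mul_assoc, h1, hW]
        simp [twistFirst, mul_assoc]
    simpa [twistFirst] using h5
  have hl : ∀ X : U ⊗[k] U, χ ((1 : U) ⊗ₜ[k] x * X) = x * χ X := by
    intro X
    induction X with
    | zero => simp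
    | add a b ha hb => simp only [map_add, mul_add, ha, hb]
    | tmul a b => simp [χ]
  have hr : ∀ X : U ⊗[k] U, χ (X * (1 : U) ⊗ₜ[k] x) = χ X * x := by
    intro X
    induction X with
    | zero => simp
    | add a b ha hb => simp only [map_add, add_mul, ha, hb]
    | tmul a b => simp [χ]
  rw [hl, hr] at h4
  exact h4

end IsUniversalRMatrix

/-! ### The projection of the double onto its positive half -/

namespace QuantumDouble

open Coalgebra HopfAlgebra TensorProduct Bialgebra IsUniversalRMatrix

variable {k Um Up U : Type*} [CommRing k]
  [Ring Um] [HopfAlgebra k Um] [Ring Up] [HopfAlgebra k Up] [Ring U] [HopfAlgebra k U]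
  [Module.Free k Um] [Module.Finite k Um] (Q : QuantumDouble k Um Up U)

@[simp] lemma inclPlus_toCoalgHom_apply (x : Up) : Q.inclPlus.toCoalgHom x = Q.inclPlus x := rfl

@[simp] lemma inclMinus_toCoalgHom_apply (a : Um) :
    Q.inclMinus.toCoalgHom a = Q.inclMinus a := rfl

lemma projPlus_mul (a : Um) (x : Up) :
    Q.projPlus (Q.inclMinus a * Q.inclPlus x) = counit (R := k) a • x := by
  have h : (LinearEquiv.ofBijective _ Q.bijective).symm (Q.inclMinus a * Q.inclPlus x) =
      a ⊗ₜ[k] x := by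
    rw [LinearEquiv.symm_apply_eq]
    rfl
  simp only [projPlus, LinearMap.comp_apply, LinearEquiv.coe_coe]
  rw [h]
  simp

/-- A linear map on `U` is determined by its values on products `a * x`, `a ∈ Um`, `x ∈ Up`. -/
lemma linearMap_ext {M : Type*} [AddCommGroup M] [Module k M] {f g : U →ₗ[k] M}
    (h : ∀ (a : Um) (x : Up), f (Q.inclMinus a * Q.inclPlus x) =
      g (Q.inclMinus a * Q.inclPlus x)) : f = g := by
  refine LinearMap.ext fun w => ?_
  obtain ⟨t, rfl⟩ := Q.bijective.surjective w
  induction t with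
  | zero => simp
  | add s t hs ht => simp only [map_add, hs, ht]
  | tmul a x => exact h a x

lemma projPlus_minus_mul (a : Um) (w : U) :
    Q.projPlus (Q.inclMinus a * w) = counit (R := k) a • Q.projPlus w := by
  refine LinearMap.congr_fun (Q.linearMap_ext
    (f := Q.projPlus ∘ₗ LinearMap.mulLeft k (Q.inclMinus a))
    (g := counit (R := k) a • Q.projPlus) fun b x => ?_) w
  simp [← mul_assoc, ← map_mul, projPlus_mul, mul_smul]

/-- The projection `a * x ↦ ε(a) x` as an endomorphism of `U`. -/
noncomputable def proj : U →ₗ[k] U := Q.inclPlus.toLinearMap ∘ₗ Q.projPlus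

lemma proj_apply (w : U) : Q.proj w = Q.inclPlus (Q.projPlus w) := rfl

lemma proj_mul (a : Um) (x : Up) :
    Q.proj (Q.inclMinus a * Q.inclPlus x) = counit (R := k) a • Q.inclPlus x := by
  rw [proj_apply, projPlus_mul, map_smul]

lemma proj_minus_mul (a : Um) (w : U) :
    Q.proj (Q.inclMinus a * w) = counit (R := k) a • Q.proj w := by
  rw [proj_apply, projPlus_minus_mul, map_smul, proj_apply]

lemma proj_inclPlus (x : Up) : Q.proj (Q.inclPlus x) = Q.inclPlus x := by
  simpa using Q.proj_mul 1 x

lemma comul_inclPlus (x : Up) : comul (R := k) (Q.inclPlus x) =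
    map Q.inclPlus.toLinearMap Q.inclPlus.toLinearMap (comul (R := k) x) :=
  (CoalgHomClass.map_comp_comul_apply Q.inclPlus x).symm

lemma comul_inclMinus (a : Um) : comul (R := k) (Q.inclMinus a) =
    map Q.inclMinus.toLinearMap Q.inclMinus.toLinearMap (comul (R := k) a) :=
  (CoalgHomClass.map_comp_comul_apply Q.inclMinus a).symm

lemma isUniversal : IsUniversalRMatrix k Q.R := Q.universal

/-- The inverse `(S ⊗ id)(R)` of the universal R-matrix. -/
noncomputable def RInv : U ⊗[k] U := map (antipode k) LinearMap.id Q.R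

/-- The map `a ⊗ b ↦ b S(π(a))`, where `π` is the projection `Q.proj`. -/
noncomputable def foldProj : U ⊗[k] U →ₗ[k] U :=
  mulOp k U ∘ₗ map (antipode k ∘ₗ Q.proj) LinearMap.id

@[simp] lemma foldProj_tmul (a b : U) :
    Q.foldProj (a ⊗ₜ[k] b) = b * antipode k (Q.proj a) := rfl

lemma foldProj_tmul_mul (c : U) (X : U ⊗[k] U) :
    Q.foldProj ((1 : U) ⊗ₜ[k] c * X) = c * Q.foldProj X := by
  induction X with
  | zero => simp
  | add a b ha hb => simp only [mul_add, map_add, ha, hb]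
  | tmul a b => simp [mul_assoc]

/-- The projection absorbs `R`, because the first factor of `R` lies in `Um`, where it acts through
`ε`, and `(ε ⊗ id)(R) = 1`. -/
lemma foldProj_R_mul (X : U ⊗[k] U) : Q.foldProj (Q.R * X) = Q.foldProj X := by
  have h : ∀ s : Um ⊗[k] Up,
      Q.foldProj (map Q.inclMinus.toLinearMap Q.inclPlus.toLinearMap s * X) =
      Algebra.TensorProduct.lid k U
        (Algebra.TensorProduct.map (counitAlgHom k U) (AlgHom.id k U)
          (map Q.inclMinus.toLinearMap Q.inclPlus.toLinearMap s)) * Q.foldProj X := by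
    intro s
    induction s with
    | zero => simp
    | add a b ha hb => simp only [add_mul, map_add, ha, hb]
    | tmul a x =>
      induction X with
      | zero => simp
      | add a b ha hb => simp only [mul_add, map_add, ha, hb]
      | tmul c d => simp [proj_minus_mul, mul_assoc]
  have h1 := h (canonicalElement Q.pair Q.perfect)
  rw [Q.universal.counit_left, one_mul] at h1
  exact h1

lemma foldProj_RInv_mul (X : U ⊗[k] U) : Q.foldProj (Q.RInv * X) = Q.foldProj X := by
  rw [← foldProj_R_mul, ← mul_assoc]
  have h : Q.R * Q.RInv = 1 := Q.isUniversal.mul_antipode_left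
  rw [h, one_mul]

lemma foldProj_flip_comul (x : Up) :
    Q.foldProj (flip21 (comul (R := k) (Q.inclPlus x))) = counit (R := k) x • (1 : U) := by
  have h : ∀ t : Up ⊗[k] Up, Q.foldProj (flip21 (map Q.inclPlus.toLinearMap
      Q.inclPlus.toLinearMap t)) = LinearMap.mul' k U ((antipode k).lTensor U
        (map Q.inclPlus.toLinearMap Q.inclPlus.toLinearMap t)) := by
    intro t
    induction t with
    | zero => simp [flip21]
    | add a b ha hb => simp only [flip21, map_add] at ha hb ⊢; simp only [ha, hb]
    | tmul a b => simp [flip21, proj_inclPlus]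
  rw [comul_inclPlus, h, ← comul_inclPlus, mul_antipode_lTensor_comul_apply]
  simp [Algebra.algebraMap_eq_smul_one]

lemma comul_mul_RInv (x : U) :
    comul (R := k) x * Q.RInv = Q.RInv * flip21 (comul (R := k) x) := by
  have h1 : Q.R * Q.RInv = 1 := Q.isUniversal.mul_antipode_left
  have h2 : Q.RInv * Q.R = 1 := Q.isUniversal.antipode_left_mul
  have h3 := congrArg (fun t => Q.RInv * t * Q.RInv) (Q.isUniversal.intertwine x)
  change Q.RInv * (Q.R * _) * _ = Q.RInv * (_ * Q.R) * _ at h3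
  simpa only [mul_assoc, h1, mul_one, ← mul_assoc Q.RInv Q.R, h2, one_mul] using h3

/-- For `v ∈ Up` and `R⁻¹ = σ ⊗ σ'`, one has `σ' S(π(v σ)) = S⁻¹(v)`: write
`v ⊗ 1 = (1 ⊗ S⁻¹(v₍₂₎)) Δ(v₍₁₎)` and move `R⁻¹` to the left, where `π` absorbs it. -/
lemma foldProj_mul_RInv (x : Up) :
    Q.foldProj (Q.inclPlus x ⊗ₜ[k] (1 : U) * Q.RInv) =
      Q.isUniversal.antipodeInv (Q.inclPlus x) := by
  rw [← map_right_comul_comul (mulOp k U ∘ₗ map LinearMap.id Q.isUniversal.antipodeInv)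
    Q.isUniversal.antipodeInv_mul_comul, comul_inclPlus]
  have hx : Q.isUniversal.antipodeInv (Q.inclPlus x) =
      TensorProduct.lid k U (map (counit (R := k)) (Q.isUniversal.antipodeInv ∘ₗ
        Q.inclPlus.toLinearMap) (comul (R := k) x)) := by
    have h := congrArg (fun t => TensorProduct.lid k U
      (map LinearMap.id (Q.isUniversal.antipodeInv ∘ₗ Q.inclPlus.toLinearMap) t))
      (rTensor_counit_comul (R := k) x)
    rw [LinearMap.rTensor, TensorProduct.map_map, LinearMap.id_comp, LinearMap.comp_id] at h
    rw [h]; simp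
  rw [hx]
  induction comul (R := k) x with
  | zero => simp
  | add a b ha hb => simp only [map_add, add_mul, ha, hb]
  | tmul a c =>
    have h : ∀ t : U ⊗[k] U, map LinearMap.id
        (mulOp k U ∘ₗ map LinearMap.id Q.isUniversal.antipodeInv)
        (TensorProduct.assoc k U U U (t ⊗ₜ[k] Q.inclPlus c)) =
        (1 : U) ⊗ₜ[k] Q.isUniversal.antipodeInv (Q.inclPlus c) * t := by
      intro t
      induction t with
      | zero => simp
      | add a b ha hb => simp only [add_tmul, map_add, mul_add, ha, hb]
      | tmul d e => simp
    rw [TensorProduct.map_tmul, LinearMap.rTensor_tmul]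
    change Q.foldProj (TensorProduct.map LinearMap.id _ (TensorProduct.assoc k U U U
      (comul (R := k) (Q.inclPlus a) ⊗ₜ[k] Q.inclPlus c)) * _) = _
    rw [h, mul_assoc, foldProj_tmul_mul, comul_mul_RInv, foldProj_RInv_mul, foldProj_flip_comul]
    simp

end QuantumDouble

/-! ### Trace identities -/

/-- The map `y ⊗ a ⊗ b ↦ τ(y g(a)) b`. -/
noncomputable def traceContract {k U : Type*} [CommRing k] [Ring U] [Algebra k U]
    (τ : U →ₗ[k] k) (g : U →ₗ[k] U) : U ⊗[k] (U ⊗[k] U) →ₗ[k] U :=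
  (TensorProduct.lid k U).toLinearMap ∘ₗ
    TensorProduct.map (τ ∘ₗ LinearMap.mul' k U ∘ₗ g.lTensor U) LinearMap.id ∘ₗ
      (TensorProduct.assoc k U U U).symm.toLinearMap

@[simp] lemma traceContract_tmul {k U : Type*} [CommRing k] [Ring U] [Algebra k U]
    (τ : U →ₗ[k] k) (g : U →ₗ[k] U) (y a b : U) :
    traceContract τ g (y ⊗ₜ[k] (a ⊗ₜ[k] b)) = τ (y * g a) • b := by
  simp [traceContract]

lemma traceContract_smul {k U : Type*} [CommRing k] [Ring U] [Algebra k U]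
    (τ : U →ₗ[k] k) (c : k) (g : U →ₗ[k] U) (X : U ⊗[k] (U ⊗[k] U)) :
    traceContract τ (c • g) X = c • traceContract τ g X := by
  induction X with
  | zero => simp
  | add a b ha hb => simp only [map_add, smul_add, ha, hb]
  | tmul y t =>
    induction t with
    | zero => simp
    | add a b ha hb => simp only [map_add, TensorProduct.tmul_add, smul_add, ha, hb]
    | tmul a b => simp [mul_smul]

/-- For endomorphisms `p`, `q` of `U`, the map sending `s ⊗ t` to the endomorphism
`a ↦ q(t a) p(s)`. -/
noncomputable def convMul {k U : Type*} [CommRing k] [Ring U] [Algebra k U]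
    (p q : U →ₗ[k] U) : U ⊗[k] U →ₗ[k] U →ₗ[k] U :=
  TensorProduct.lift (LinearMap.mk₂ k
    (fun s t => LinearMap.mulRight k (p s) ∘ₗ q ∘ₗ LinearMap.mulLeft k t)
    (fun a b t => by ext; simp [mul_add]) (fun c a t => by ext; simp)
    (fun a s t => by ext; simp [add_mul]) (fun c a t => by ext; simp))

@[simp] lemma convMul_tmul {k U : Type*} [CommRing k] [Ring U] [Algebra k U]
    (p q : U →ₗ[k] U) (s t a : U) :
    convMul p q (s ⊗ₜ[k] t) a = q (t * a) * p s := rfl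

namespace QuantumDouble

open Coalgebra HopfAlgebra TensorProduct Bialgebra IsUniversalRMatrix

variable {k Um Up U : Type*} [CommRing k]
  [Ring Um] [HopfAlgebra k Um] [Ring Up] [HopfAlgebra k Up] [Ring U] [HopfAlgebra k U]
  [Module.Free k Um] [Module.Finite k Um] (Q : QuantumDouble k Um Up U)

/-- The map sending `s ⊗ t` to the endomorphism `a ↦ S(π(t a)) π(s)` of `U`, where `π` is the
projection `Q.proj`. -/
noncomputable def convProj : U ⊗[k] U →ₗ[k] U →ₗ[k] U := convMul Q.proj (antipode k ∘ₗ Q.proj)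

@[simp] lemma convProj_tmul (s t a : U) :
    Q.convProj (s ⊗ₜ[k] t) a = antipode k (Q.proj (t * a)) * Q.proj s := rfl

/-- On products `a x` the endomorphism attached to `Δ(a x)` depends on `a ∈ Um` only through
`ε(a)`. -/
lemma convProj_comul_mul (a : Um) (x : Up) :
    Q.convProj (comul (R := k) (Q.inclMinus a * Q.inclPlus x)) =
      counit (R := k) a • Q.convProj (comul (R := k) (Q.inclPlus x)) := by
  rw [Bialgebra.comul_mul, comul_inclMinus]
  rw [← lid_map_counit_comul a]
  induction comul (R := k) a with
  | zero => simp
  | add a b ha hb => simp only [map_add, add_mul, add_smul, ha, hb]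
  | tmul a b =>
    induction comul (R := k) (Q.inclPlus x) with
    | zero => simp
    | add a b ha hb => simp only [map_add, mul_add, smul_add, ha, hb]
    | tmul c d =>
      ext e
      simp [mul_assoc, proj_minus_mul, smul_smul]

/-- For `b, x ∈ Up` and `R⁻¹ = σ ⊗ σ'`, one has
`σ' S(π(x₍₂₎ b σ)) x₍₁₎ = S⁻¹(x₍₂₎ b) x₍₁₎ = ε(x) S⁻¹(b)`. -/
lemma convProj_comul_RInv (x b : Up) :
    mulOp k U (TensorProduct.map (Q.convProj (comul (R := k) (Q.inclPlus x)) ∘ₗ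
      LinearMap.mulLeft k (Q.inclPlus b)) LinearMap.id Q.RInv) =
      counit (R := k) x • Q.isUniversal.antipodeInv (Q.inclPlus b) := by
  have h : ∀ (s t : Up) (X : U ⊗[k] U), mulOp k U (TensorProduct.map (Q.convProj
      (Q.inclPlus s ⊗ₜ[k] Q.inclPlus t) ∘ₗ LinearMap.mulLeft k (Q.inclPlus b)) LinearMap.id X) =
      Q.foldProj (Q.inclPlus (t * b) ⊗ₜ[k] (1 : U) * X) * Q.inclPlus s := by
    intro s t X
    induction X with
    | zero => simp
    | add a b ha hb => simp only [map_add, mul_add, add_mul, ha, hb]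
    | tmul c d => simp [proj_inclPlus, mul_assoc]
  have h2 : ∀ t : Up ⊗[k] Up, mulOp k U (TensorProduct.map (Q.convProj
      (TensorProduct.map Q.inclPlus.toLinearMap Q.inclPlus.toLinearMap t) ∘ₗ
        LinearMap.mulLeft k (Q.inclPlus b)) LinearMap.id Q.RInv) =
      Q.isUniversal.antipodeInv (Q.inclPlus b) * mulOp k U (TensorProduct.map LinearMap.id
        Q.isUniversal.antipodeInv (TensorProduct.map Q.inclPlus.toLinearMap Q.inclPlus.toLinearMap t)) := by
    intro t
    induction t with
    | zero => simp
    | add a b ha hb =>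
      simp only [map_add, mul_add, LinearMap.add_comp, TensorProduct.map_add_left,
        LinearMap.add_apply, ha, hb]
    | tmul c d =>
      refine (h c d _).trans ?_
      rw [foldProj_mul_RInv, map_mul, antipodeInv_mul]
      simp [mul_assoc]
  rw [comul_inclPlus, h2, ← comul_inclPlus, antipodeInv_mul_comul]
  simp

/-- The trace identity behind the formula for `⟨T̃, h ⊗ id⟩`, for the tensor
`φ(R⁻¹)₁₂ W₁₃ R₂₁⁻¹` and a twisted trace `τ`. -/
lemma traceContract_convProj (φ : U ≃ₐ[k] U)
    (hφ : Algebra.TensorProduct.map (φ : U →ₐ[k] U) (φ : U →ₐ[k] U) Q.R = Q.R)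
    (τ : U →ₗ[k] k) (hτ : ∀ x y : U, τ (y * x) = τ (φ x * y)) (W : U ⊗[k] U) (x : Up) :
    traceContract τ (Q.convProj (comul (R := k) (Q.inclPlus x)))
      (leg12 k U U U (twistFirst φ Q.RInv) * leg13 k U U U W * leg12 k U U U (flip21 Q.RInv)) =
    counit (R := k) x • TensorProduct.lid k U (TensorProduct.map τ LinearMap.id
      (((↑Q.isUniversal.drinfeldUnit⁻¹ : U) ⊗ₜ[k] (1 : U)) * W)) := by
  set g := Q.convProj (comul (R := k) (Q.inclPlus x)) with hg
  have h1 : ∀ (ρ ρ' y y' : U) (X : U ⊗[k] U), traceContract τ g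
      (leg12 k U U U (twistFirst φ (ρ ⊗ₜ[k] ρ')) * leg13 k U U U (y ⊗ₜ[k] y') *
        leg12 k U U U (flip21 X)) =
      τ (y * mulOp k U (TensorProduct.map (g ∘ₗ LinearMap.mulLeft k ρ') LinearMap.id X) * ρ) • y' := by
    intro ρ ρ' y y' X
    induction X with
    | zero => simp [flip21]
    | add a b ha hb =>
      simp only [flip21, map_add, mul_add, add_mul, add_smul] at ha hb ⊢
      simp only [ha, hb]
    | tmul c d =>
      have h := hτ ρ (y * (d * g (ρ' * c)))
      simp only [mul_assoc] at h
      simp [flip21, twistFirst, h, mul_assoc]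
  have h2 : ∀ s : Um ⊗[k] Up, traceContract τ g
      (leg12 k U U U (twistFirst φ (TensorProduct.map (antipode k) LinearMap.id
        (TensorProduct.map Q.inclMinus.toLinearMap Q.inclPlus.toLinearMap s))) * leg13 k U U U W *
        leg12 k U U U (flip21 Q.RInv)) =
      counit (R := k) x • TensorProduct.lid k U (TensorProduct.map τ LinearMap.id (W *
        (mulOp k U (TensorProduct.map LinearMap.id Q.isUniversal.antipodeInv (TensorProduct.map (antipode k) LinearMap.id
        (TensorProduct.map Q.inclMinus.toLinearMap Q.inclPlus.toLinearMap s))) ⊗ₜ[k] (1 : U)))) := by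
    intro s
    induction s with
    | zero => simp
    | add a b ha hb => simp only [map_add, mul_add, add_mul, add_tmul, smul_add, ha, hb]
    | tmul a b =>
      induction W with
      | zero => simp
      | add a b ha hb => simp only [map_add, mul_add, add_mul, smul_add, ha, hb]
      | tmul y y' =>
        refine (h1 _ _ y y' _).trans ?_
        rw [hg, LinearMap.id_apply, show Q.inclPlus.toLinearMap b = Q.inclPlus b from rfl,
          convProj_comul_RInv]
        simp [mul_assoc, mul_smul]
  have h3 : traceContract τ g
      (leg12 k U U U (twistFirst φ Q.RInv) * leg13 k U U U W * leg12 k U U U (flip21 Q.RInv)) =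
      counit (R := k) x • TensorProduct.lid k U (TensorProduct.map τ LinearMap.id (W *
        (mulOp k U (TensorProduct.map LinearMap.id Q.isUniversal.antipodeInv Q.RInv) ⊗ₜ[k]
          (1 : U)))) := h2 (canonicalElement Q.pair Q.perfect)
  have h4 : mulOp k U (TensorProduct.map LinearMap.id Q.isUniversal.antipodeInv Q.RInv) =
      ↑Q.isUniversal.drinfeldUnit⁻¹ := Q.isUniversal.mulOp_antipodeInv_inv
  rw [h4] at h3
  refine h3.trans ?_
  congr 2
  clear h3 h2
  induction W with
  | zero => simp
  | add a b ha hb => simp only [map_add, mul_add, add_mul, ha, hb]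
  | tmul y y' => simp [hτ _ y, Q.isUniversal.map_drinfeldUnit_inv φ hφ]

/-- The projection `π = Q.proj` is a morphism of coalgebras. -/
lemma comul_proj (w : U) : comul (R := k) (Q.proj w) = TensorProduct.map Q.proj Q.proj (comul (R := k) w) := by
  refine LinearMap.congr_fun (Q.linearMap_ext (f := comul (R := k) ∘ₗ Q.proj)
    (g := TensorProduct.map Q.proj Q.proj ∘ₗ comul (R := k)) fun a x => ?_) w
  simp only [LinearMap.comp_apply]
  rw [Bialgebra.comul_mul, comul_inclMinus, proj_mul, map_smul, comul_inclPlus]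
  rw [← lid_map_counit_comul a]
  induction comul (R := k) a with
  | zero => simp
  | add a b ha hb => simp only [map_add, add_mul, add_smul, ha, hb]
  | tmul a b =>
    induction comul (R := k) x with
    | zero => simp
    | add a b ha hb => simp only [map_add, mul_add, smul_add, ha, hb]
    | tmul c d => simp [proj_mul, smul_smul, mul_comm, smul_tmul']

lemma counit_proj (w : U) : counit (R := k) (Q.proj w) = counit (R := k) w := by
  refine LinearMap.congr_fun (Q.linearMap_ext (f := counit (R := k) ∘ₗ Q.proj)
    (g := counit (R := k)) fun a x => ?_) w
  simp [proj_mul]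

end QuantumDouble

/-! ### Elements of `U ⊗ F` as endomorphisms of `U` -/

open Coalgebra HopfAlgebra Bialgebra IsUniversalRMatrix HeisenbergDouble

section Canonical

variable {k M N : Type*} [CommRing k] [AddCommGroup M] [Module k M]
    [AddCommGroup N] [Module k N] [Module.Free k M] [Module.Finite k M]

lemma pair_canonicalElement (B : M →ₗ[k] N →ₗ[k] k) (hB : B.IsPerfPair) (m : M) :
    TensorProduct.rid k M (TensorProduct.map LinearMap.id (B m) (canonicalElement B hB)) = m := by
  have h : ∀ ℓ : Module.Dual k M,
      B m ((LinearEquiv.ofBijective B.flip hB.bijective_right).symm ℓ) = ℓ m := fun ℓ =>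
    LinearMap.congr_fun ((LinearEquiv.ofBijective B.flip hB.bijective_right).apply_symm_apply ℓ) m
  simp only [canonicalElement, map_sum, TensorProduct.map_tmul, LinearMap.id_apply,
    TensorProduct.rid_tmul, h, Module.Basis.coord_apply]
  exact (Module.Free.chooseBasis k M).sum_repr m

end Canonical

namespace HopfDuality

variable {k U F : Type*} [CommRing k] [Ring U] [HopfAlgebra k U] [Ring F] [HopfAlgebra k F]
  (P : HopfDuality k U F)

/-- An element of `F ⊗ A` is determined by its contractions with the elements of `U`. -/
lemma lid_pair_ext [Module.Free k U] [Module.Finite k U] {A : Type*} [AddCommGroup A] [Module k A]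
    {X Z : F ⊗[k] A}
    (h : ∀ v : U, TensorProduct.lid k A (TensorProduct.map (P.pair v) LinearMap.id X) =
      TensorProduct.lid k A (TensorProduct.map (P.pair v) LinearMap.id Z)) : X = Z := by
  let e : F ⊗[k] A ≃ₗ[k] (U →ₗ[k] A) :=
    (TensorProduct.congr P.equivDual (LinearEquiv.refl k A)).trans (dualTensorHomEquiv k U A)
  have he : ∀ (X : F ⊗[k] A) (v : U),
      e X v = TensorProduct.lid k A (TensorProduct.map (P.pair v) LinearMap.id X) := by
    intro X v
    induction X with
    | zero => simp
    | add a b ha hb => simp only [map_add, LinearMap.add_apply, ha, hb]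
    | tmul f a => simp [e, equivDual]
  refine e.injective (LinearMap.ext fun v => ?_)
  rw [he, he, h]

/-- The linear map `v ↦ (id ⊗ ⟨v, ·⟩)(X)` attached to `X ∈ A ⊗ F`. -/
noncomputable def toHom {A : Type*} [AddCommGroup A] [Module k A] :
    A ⊗[k] F →ₗ[k] U →ₗ[k] A :=
  TensorProduct.lift (LinearMap.mk₂ k (fun a f => (P.pair.flip f).smulRight a)
    (fun a b f => by ext; simp) (fun c a f => LinearMap.ext fun v => smul_comm (P.pair v f) c a)
    (fun a f g => by ext; simp [add_smul]) (fun c a f => by ext; simp [mul_smul]))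

@[simp] lemma toHom_tmul {A : Type*} [AddCommGroup A] [Module k A] (a : A) (f : F) (v : U) :
    P.toHom (a ⊗ₜ[k] f) v = P.pair v f • a := rfl

lemma toHom_apply {A : Type*} [AddCommGroup A] [Module k A] (X : A ⊗[k] F) (v : U) :
    P.toHom X v = TensorProduct.rid k A (TensorProduct.map LinearMap.id (P.pair v) X) := by
  induction X with
  | zero => simp
  | add a b ha hb => simp only [map_add, LinearMap.add_apply, ha, hb]
  | tmul a f => simp

lemma toHom_injective [Module.Free k U] [Module.Finite k U]
    {A : Type*} [AddCommGroup A] [Module k A] :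
    Function.Injective (P.toHom (A := A)) := by
  intro X Z h
  refine (TensorProduct.comm k A F).injective (P.lid_pair_ext fun v => ?_)
  have hX : ∀ X : A ⊗[k] F, TensorProduct.lid k A (TensorProduct.map (P.pair v) LinearMap.id
      (TensorProduct.comm k A F X)) = P.toHom X v := by
    intro X
    induction X with
    | zero => simp
    | add a b ha hb => simp only [map_add, LinearMap.add_apply, ha, hb]
    | tmul a f => simp
  rw [hX, hX, h]

lemma toHom_one (v : U) : P.toHom (1 : U ⊗[k] F) v = counit (R := k) v • (1 : U) := by
  rw [Algebra.TensorProduct.one_def, toHom_tmul, P.one_pair]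

lemma toHom_mul (X Z : U ⊗[k] F) (v : U) : P.toHom (X * Z) v =
    LinearMap.mul' k U (TensorProduct.map (P.toHom X) (P.toHom Z) (comul (R := k) v)) := by
  induction X with
  | zero => simp
  | add a b ha hb =>
    simp only [add_mul, map_add, LinearMap.add_apply, TensorProduct.map_add_left, ha, hb]
  | tmul a f =>
    induction Z with
    | zero => simp
    | add a b ha hb =>
      simp only [mul_add, map_add, LinearMap.add_apply, TensorProduct.map_add_right, ha, hb]
    | tmul b g =>
      rw [Algebra.TensorProduct.tmul_mul_tmul, toHom_tmul, P.mul_pair]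
      induction comul (R := k) v with
      | zero => simp
      | add a b ha hb => simp only [map_add, add_smul, ha, hb]
      | tmul c d => simp [smul_smul, mul_comm]

lemma toHom_map_left (f : U →ₗ[k] U) (X : U ⊗[k] F) :
    P.toHom (TensorProduct.map f LinearMap.id X) = f ∘ₗ P.toHom X := by
  ext v
  induction X with
  | zero => simp
  | add a b ha hb =>
    simp only [map_add, LinearMap.add_apply, LinearMap.comp_apply] at ha hb ⊢
    rw [ha, hb]
  | tmul a f => simp

/-- If the endomorphism of `U` attached to `X` is a morphism of coalgebras, then `X` is invertible
with inverse `(S ⊗ id)(X)`. -/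
lemma mul_antipode_of_comul [Module.Free k U] [Module.Finite k U] (X : U ⊗[k] F)
    (hΔ : ∀ v, comul (R := k) (P.toHom X v) =
      TensorProduct.map (P.toHom X) (P.toHom X) (comul (R := k) v))
    (hε : ∀ v, counit (R := k) (P.toHom X v) = counit (R := k) v) :
    X * TensorProduct.map (antipode k) LinearMap.id X = 1 ∧
      TensorProduct.map (antipode k) LinearMap.id X * X = 1 := by
  constructor <;> refine P.toHom_injective (LinearMap.ext fun v => ?_)
  · rw [toHom_mul, toHom_map_left, toHom_one]
    have h := mul_antipode_lTensor_comul_apply (R := k) (P.toHom X v)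
    rw [hΔ, LinearMap.lTensor, TensorProduct.map_map, LinearMap.id_comp, hε] at h
    rw [h, Algebra.algebraMap_eq_smul_one]
  · rw [toHom_mul, toHom_map_left, toHom_one]
    have h := mul_antipode_rTensor_comul_apply (R := k) (P.toHom X v)
    rw [hΔ, LinearMap.rTensor, TensorProduct.map_map, LinearMap.id_comp, hε] at h
    rw [h, Algebra.algebraMap_eq_smul_one]

lemma toHom_T [Module.Free k U] [Module.Finite k U] : P.toHom P.T = LinearMap.id :=
  LinearMap.ext fun v => by rw [toHom_apply]; exact pair_canonicalElement P.pair P.perfect v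

lemma isUnit_T [Module.Free k U] [Module.Finite k U] : IsUnit P.T := by
  have h := P.mul_antipode_of_comul P.T (by simp [toHom_T]) (by simp [toHom_T])
  exact ⟨⟨_, _, h.1, h.2⟩, rfl⟩

lemma pair_pullback (φ : U ≃ₐ[k] U) (x : U) (f : F) :
    P.pair x (P.pullback φ f) = P.pair (φ x) f :=
  LinearMap.congr_fun (P.equivDual.apply_symm_apply (φ.toLinearMap.dualMap (P.equivDual f))) x

/-- Twisted cocommutativity of `h` says that `h` is a twisted trace on `U`. -/
lemma IsTwistedCocommutative.pair_mul {φ : U ≃ₐ[k] U} {h : F}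
    (hh : P.IsTwistedCocommutative φ h) (x y : U) :
    P.pair (y * x) h = P.pair (φ x * y) h := by
  have h1 := congrArg (fun t => LinearMap.mul' k k
    (TensorProduct.map (P.pair x) (P.pair y) t)) hh
  rw [P.pair_mul, P.pair_mul]
  convert h1 using 1
  · induction comul (R := k) h with
    | zero => simp
    | add a b ha hb => simp only [map_add, ha, hb]
    | tmul a b => simp [mul_comm]
  · induction comul (R := k) h with
    | zero => simp
    | add a b ha hb => simp only [map_add, ha, hb]
    | tmul a b => simp [pair_pullback]

/-- Twisted invariance of `Y`, contracted with the elements of `U`. -/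
lemma mul_twist_comul [Module.Free k U] [Module.Finite k U] (φ : U ≃ₐ[k] U) (Y : U ⊗[k] U)
    (hY : leg12 k U U F Y * leg13 k U U F (twistFirst φ P.T) * leg23 k U U F P.T =
      leg13 k U U F P.T * leg23 k U U F P.T * leg12 k U U F Y) (v : U) :
    Y * twistFirst φ (comul (R := k) v) = comul (R := k) v * Y := by
  let E : U ⊗[k] (U ⊗[k] F) →ₗ[k] U ⊗[k] U :=
    TensorProduct.map LinearMap.id
      ((TensorProduct.rid k U).toLinearMap ∘ₗ TensorProduct.map LinearMap.id (P.pair v))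
  have hl : ∀ (Y : U ⊗[k] U) (M : U ⊗[k] (U ⊗[k] F)), E (leg12 k U U F Y * M) = Y * E M := by
    intro Y M
    induction Y with
    | zero => simp
    | add a b ha hb => simp only [map_add, add_mul, ha, hb]
    | tmul a b =>
      induction M with
      | zero => simp
      | add a b ha hb => simp only [map_add, mul_add, ha, hb]
      | tmul c t =>
        induction t with
        | zero => simp
        | add a b ha hb => simp only [map_add, TensorProduct.tmul_add, mul_add, ha, hb]
        | tmul d f => simp [E]
  have hr : ∀ (Y : U ⊗[k] U) (M : U ⊗[k] (U ⊗[k] F)), E (M * leg12 k U U F Y) = E M * Y := by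
    intro Y M
    induction Y with
    | zero => simp
    | add a b ha hb => simp only [map_add, mul_add, ha, hb]
    | tmul a b =>
      induction M with
      | zero => simp
      | add a b ha hb => simp only [map_add, add_mul, ha, hb]
      | tmul c t =>
        induction t with
        | zero => simp
        | add a b ha hb => simp only [map_add, TensorProduct.tmul_add, add_mul, ha, hb]
        | tmul d f => simp [E]
  have hm : ∀ X Z : U ⊗[k] F, E (leg13 k U U F X * leg23 k U U F Z) =
      TensorProduct.map (P.toHom X) (P.toHom Z) (comul (R := k) v) := by
    intro X Z
    induction X with
    | zero => simp
    | add a b ha hb => simp only [map_add, add_mul, TensorProduct.map_add_left,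
        LinearMap.add_apply, ha, hb]
    | tmul a f =>
      induction Z with
      | zero => simp
      | add a b ha hb => simp only [map_add, mul_add, TensorProduct.map_add_right,
          LinearMap.add_apply, ha, hb]
      | tmul b g =>
        simp only [leg13_tmul, leg23_tmul, Algebra.TensorProduct.tmul_mul_tmul, one_mul, mul_one,
          E, TensorProduct.map_tmul, LinearMap.id_apply, LinearMap.comp_apply,
          LinearEquiv.coe_coe, TensorProduct.rid_tmul, P.mul_pair]
        induction comul (R := k) v with
        | zero => simp
        | add a b ha hb => simp only [map_add, add_smul, TensorProduct.tmul_add, ha, hb]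
        | tmul c d =>
          simp [TensorProduct.smul_tmul', TensorProduct.tmul_smul, smul_smul, mul_comm]
  have hT : P.toHom (twistFirst φ P.T) = φ.toLinearMap :=
    (P.toHom_map_left φ.toLinearMap P.T).trans (by rw [toHom_T, LinearMap.comp_id])
  have h := congrArg E hY
  rw [mul_assoc, hl, hr, hm, hm, hT, toHom_T, TensorProduct.map_id] at h
  exact h

end HopfDuality

/-! ### Contractions of the Heisenberg double -/

lemma flip21_mul {k U : Type*} [CommRing k] [Ring U] [Algebra k U] (X Z : U ⊗[k] U) :
    flip21 (X * Z) = flip21 X * flip21 Z :=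
  map_mul (Algebra.TensorProduct.comm k U U) X Z

lemma flip21_one {k U : Type*} [CommRing k] [Ring U] [Algebra k U] :
    flip21 (1 : U ⊗[k] U) = 1 :=
  map_one (Algebra.TensorProduct.comm k U U)

section ConvMul

variable {k U : Type*} [CommRing k] [Ring U] [Algebra k U]

lemma convMul_add_left (p p' q : U →ₗ[k] U) (t : U ⊗[k] U) :
    convMul (p + p') q t = convMul p q t + convMul p' q t := by
  induction t with
  | zero => simp
  | add a b ha hb => simp only [map_add, ha, hb]; abel
  | tmul a b => ext c; simp [mul_add]

lemma convMul_add_right (p q q' : U →ₗ[k] U) (t : U ⊗[k] U) :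
    convMul p (q + q') t = convMul p q t + convMul p q' t := by
  induction t with
  | zero => simp
  | add a b ha hb => simp only [map_add, ha, hb]; abel
  | tmul a b => ext c; simp [add_mul]

lemma convMul_zero_left (q : U →ₗ[k] U) (t : U ⊗[k] U) : convMul 0 q t = 0 := by
  simpa using convMul_add_left 0 0 q t

lemma convMul_zero_right (p : U →ₗ[k] U) (t : U ⊗[k] U) : convMul p 0 t = 0 := by
  simpa using convMul_add_right p 0 0 t

lemma traceContract_add_left (τ : U →ₗ[k] k) (g g' : U →ₗ[k] U) (X : U ⊗[k] (U ⊗[k] U)) :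
    traceContract τ (g + g') X = traceContract τ g X + traceContract τ g' X := by
  induction X with
  | zero => simp
  | add a b ha hb => simp only [map_add, ha, hb]; abel
  | tmul y t =>
    induction t with
    | zero => simp
    | add a b ha hb => simp only [map_add, TensorProduct.tmul_add, ha, hb]; abel
    | tmul a b => simp [mul_add, add_smul]

lemma traceContract_zero_left (τ : U →ₗ[k] k) (X : U ⊗[k] (U ⊗[k] U)) :
    traceContract τ 0 X = 0 := by
  simpa using traceContract_add_left τ 0 0 X

end ConvMul

namespace HopfDuality

variable {k U F : Type*} [CommRing k] [Ring U] [HopfAlgebra k U] [Ring F] [HopfAlgebra k F]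
  (P : HopfDuality k U F)

/-- The module underlying the Heisenberg double. -/
def tensorEquiv : HeisenbergDouble P ≃ₗ[k] F ⊗[k] U := LinearEquiv.refl k (F ⊗[k] U)

@[simp] lemma tensorEquiv_ofF_mul_ofU (f : F) (x : U) :
    P.tensorEquiv (ofF P f * ofU P x) = f ⊗ₜ[k] x := by
  change P.smashMul (f ⊗ₜ[k] (1 : U)) ((1 : F) ⊗ₜ[k] x) = f ⊗ₜ[k] x
  rw [smashMul_tmul, map_one, mul_one, mulF_tmul, mul_one]

/-- The Heisenberg double is spanned by the products `f x`, `f ∈ F`, `x ∈ U`. -/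
lemma double_induction {p : HeisenbergDouble P → Prop} (zero : p 0)
    (mul : ∀ f x, p (ofF P f * ofU P x)) (add : ∀ a b, p a → p b → p (a + b))
    (d : HeisenbergDouble P) : p d := by
  obtain ⟨t, rfl⟩ := P.tensorEquiv.symm.surjective d
  induction t with
  | zero => rwa [map_zero]
  | add a b ha hb => rw [map_add]; exact add _ _ ha hb
  | tmul f x =>
    rw [← tensorEquiv_ofF_mul_ofU, LinearEquiv.symm_apply_apply]
    exact mul f x

/-- The contraction of the factor `F` of the Heisenberg double with elements of `U`: `f x` is sent
to the map `v ↦ ⟨v, f⟩ x`. -/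
noncomputable def evalDouble : HeisenbergDouble P →ₗ[k] U →ₗ[k] U :=
  P.toHom ∘ₗ (TensorProduct.comm k F U).toLinearMap ∘ₗ P.tensorEquiv.toLinearMap

@[simp] lemma evalDouble_ofF_mul_ofU (f : F) (x v : U) :
    P.evalDouble (ofF P f * ofU P x) v = P.pair v f • x := by
  simp [evalDouble]

lemma evalDouble_ofU (x v : U) : P.evalDouble (ofU P x) v = counit (R := k) v • x := by
  have h := P.evalDouble_ofF_mul_ofU 1 x v
  rwa [map_one, one_mul, P.one_pair] at h

lemma evalDouble_injective [Module.Free k U] [Module.Finite k U] :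
    Function.Injective P.evalDouble :=
  P.toHom_injective.comp ((TensorProduct.comm k F U).injective.comp P.tensorEquiv.injective)

/-- `x f = f₍₁₎ ⟨x₍₁₎, f₍₂₎⟩ x₍₂₎`, contracted with `v ∈ U`. -/
lemma evalDouble_ofU_mul_ofF (v x : U) (f : F) : P.evalDouble (ofU P x * ofF P f) v =
    TensorProduct.lid k U (TensorProduct.map (P.pair.flip f ∘ₗ LinearMap.mulLeft k v)
      LinearMap.id (comul (R := k) x)) := by
  have h : P.tensorEquiv (ofU P x * ofF P f) =
      TensorProduct.map (P.act.flip f) LinearMap.id (comul (R := k) x) := by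
    change P.smashMul ((1 : F) ⊗ₜ[k] x) (f ⊗ₜ[k] (1 : U)) = _
    rw [smashMul_tmul, map_one, one_mul, mulU_tmul, LinearMap.mulRight_one]
  simp only [evalDouble, LinearMap.comp_apply, LinearEquiv.coe_coe, h]
  induction comul (R := k) x with
  | zero => simp
  | add a b ha hb => simp only [map_add, LinearMap.add_apply, ha, hb]
  | tmul a b => simp [pair_act]

lemma evalDouble_ofF_mul (v : U) (f : F) (d : HeisenbergDouble P) :
    P.evalDouble (ofF P f * d) v = TensorProduct.lid k U
      (TensorProduct.map (P.pair.flip f) (P.evalDouble d) (comul (R := k) v)) := by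
  induction d using P.double_induction with
  | zero => simp
  | add a b ha hb =>
    simp only [mul_add, map_add, LinearMap.add_apply, TensorProduct.map_add_right, ha, hb]
  | mul g x =>
    rw [← mul_assoc, ← map_mul, evalDouble_ofF_mul_ofU, P.mul_pair]
    induction comul (R := k) v with
    | zero => simp
    | add a b ha hb => simp only [map_add, add_smul, ha, hb]
    | tmul a b => simp [smul_smul, mul_comm]

/-- `x T = T Δ(x)` in `U ⊗ D_H` -/
lemma ofU_mul_T [Module.Free k U] [Module.Finite k U] (x : U) :
    ((1 : U) ⊗ₜ[k] ofU P x) * inF P P.T = inF P P.T * inU P (comul (R := k) x) := by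
  let E : U → U ⊗[k] HeisenbergDouble P →ₗ[k] U ⊗[k] U := fun v =>
    TensorProduct.map LinearMap.id (P.evalDouble.flip v)
  have hE : ∀ {X Z : U ⊗[k] HeisenbergDouble P}, (∀ v, E v X = E v Z) → X = Z := by
    intro X Z h
    let e : U ⊗[k] HeisenbergDouble P ≃ₗ[k] F ⊗[k] (U ⊗[k] U) :=
      (TensorProduct.congr (LinearEquiv.refl k U) P.tensorEquiv).trans
        (TensorProduct.leftComm k U F U)
    refine e.injective (P.lid_pair_ext fun v => ?_)
    have h1 : ∀ X, TensorProduct.lid k (U ⊗[k] U)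
        (TensorProduct.map (P.pair v) LinearMap.id (e X)) = E v X := by
      intro X
      induction X with
      | zero => simp
      | add a b ha hb => simp only [map_add, ha, hb]
      | tmul a d =>
        induction d using P.double_induction with
        | zero => simp
        | add b c hb hc => simp only [map_add, TensorProduct.tmul_add, hb, hc]
        | mul f b => simp [E, e]
    rw [h1, h1, h]
  refine hE fun v => ?_
  have hl : ∀ X : U ⊗[k] F, E v (((1 : U) ⊗ₜ[k] ofU P x) * inF P X) =
      TensorProduct.map (P.toHom X ∘ₗ LinearMap.mulLeft k v) LinearMap.id (comul (R := k) x) := by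
    intro X
    induction X with
    | zero => simp
    | add a b ha hb =>
      simp only [map_add, mul_add, LinearMap.add_comp, TensorProduct.map_add_left,
        LinearMap.add_apply, ha, hb]
    | tmul a f =>
      simp only [inF, Algebra.TensorProduct.map_tmul, Algebra.TensorProduct.tmul_mul_tmul, E,
        TensorProduct.map_tmul, LinearMap.id_apply, one_mul, AlgHom.id_apply,
        LinearMap.flip_apply, evalDouble_ofU_mul_ofF]
      induction comul (R := k) x with
      | zero => simp
      | add a b ha hb => simp only [map_add, TensorProduct.tmul_add, ha, hb]
      | tmul b c => simp [TensorProduct.smul_tmul', TensorProduct.tmul_smul]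
  have hr : ∀ (X : U ⊗[k] F) (M : U ⊗[k] U), E v (inF P X * inU P M) =
      (P.toHom X v ⊗ₜ[k] (1 : U)) * M := by
    intro X M
    induction X with
    | zero => simp
    | add a b ha hb =>
      simp only [map_add, add_mul, LinearMap.add_apply, TensorProduct.add_tmul, ha, hb]
    | tmul a f =>
      induction M with
      | zero => simp
      | add a b ha hb => simp only [map_add, mul_add, ha, hb]
      | tmul b c =>
        simp only [inF, inU, Algebra.TensorProduct.map_tmul, Algebra.TensorProduct.tmul_mul_tmul,
          E, TensorProduct.map_tmul, LinearMap.id_apply, AlgHom.id_apply, LinearMap.flip_apply,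
          evalDouble_ofF_mul_ofU]
        simp [TensorProduct.smul_tmul', TensorProduct.tmul_smul]
  rw [hl, hr, toHom_T]
  simp only [LinearMap.id_comp, LinearMap.id_apply]
  induction comul (R := k) x with
  | zero => simp
  | add a b ha hb => simp only [map_add, mul_add, ha, hb]
  | tmul b c => simp

end HopfDuality

/-! ### The mixed relation, the factor `Z` and the contraction formula -/

section MixedRelation

variable {k Um Up U F : Type*} [CommRing k]
  [Ring Um] [HopfAlgebra k Um] [Ring Up] [HopfAlgebra k Up] [Ring U] [HopfAlgebra k U]
  [Ring F] [HopfAlgebra k F] [Module.Free k Um] [Module.Finite k Um]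
  [Module.Free k U] [Module.Finite k U]
  {Q : QuantumDouble k Um Up U} {P : HopfDuality k U F} {φ : U ≃ₐ[k] U}

/-- Since `x T = T Δ(x)` in `U ⊗ D_H` and `T` is invertible, the mixed relation is the formula
`(id ⊗ Δ)(Y) = R₂₁ Y₁₃ R^φ₁₂`. -/
lemma IsTwistTensor.comul_right {Y : U ⊗[k] U} (hY : IsTwistTensor Q P φ Y) :
    Algebra.TensorProduct.map (AlgHom.id k U) (comulAlgHom k U) Y =
      leg12 k U U U (flip21 Q.R) * leg13 k U U U Y * leg12 k U U U (twistFirst φ Q.R) := by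
  let j : U ⊗[k] (U ⊗[k] U) →ₐ[k] U ⊗[k] (U ⊗[k] HeisenbergDouble P) :=
    Algebra.TensorProduct.map (AlgHom.id k U) (inU P)
  have h1 : ∀ Y : U ⊗[k] U, leg13 k U U (HeisenbergDouble P) (inU P Y) *
      leg23 k U U (HeisenbergDouble P) (inF P P.T) = leg23 k U U (HeisenbergDouble P) (inF P P.T) *
        j (Algebra.TensorProduct.map (AlgHom.id k U) (comulAlgHom k U) Y) := by
    intro Y
    induction Y with
    | zero => simp
    | add a b ha hb => simp only [map_add, mul_add, add_mul, ha, hb]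
    | tmul a b =>
      have h := P.ofU_mul_T b
      simp only [inU, Algebra.TensorProduct.map_tmul, leg13_tmul] at h ⊢
      simp [leg23, j, inU, h]
  have h12 : ∀ X : U ⊗[k] U, leg12 k U U (HeisenbergDouble P) X = j (leg12 k U U U X) := by
    intro X
    induction X with
    | zero => simp
    | add a b ha hb => simp only [map_add, ha, hb]
    | tmul a b => simp [j, inU]
  have h13 : leg13 k U U (HeisenbergDouble P) (inU P Y) = j (leg13 k U U U Y) := by
    clear hY
    induction Y with
    | zero => simp
    | add a b ha hb => simp only [map_add, ha, hb]
    | tmul a b => simp [j, inU]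
  have hu : IsUnit (leg23 k U U (HeisenbergDouble P) (inF P P.T)) :=
    (P.isUnit_T.map (inF P)).map (leg23 k U U (HeisenbergDouble P))
  have h := hY.mixed
  rw [h1, h12, h12, h13, mul_assoc, mul_assoc, hu.mul_right_inj, ← map_mul, ← map_mul] at h
  -- `1 ⊗ x ↦ x` extends to a linear retraction of `D_H` onto `U`
  let r : U ⊗[k] (U ⊗[k] HeisenbergDouble P) →ₗ[k] U ⊗[k] (U ⊗[k] U) :=
    TensorProduct.map LinearMap.id (TensorProduct.map LinearMap.id (P.evalDouble.flip 1))
  have hr : ∀ X, r (j X) = X := by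
    intro X
    induction X with
    | zero => simp
    | add a b ha hb => simp only [map_add, ha, hb]
    | tmul a t =>
      induction t with
      | zero => simp
      | add a b ha hb => simp only [map_add, TensorProduct.tmul_add, ha, hb]
      | tmul b c => simp [r, j, inU, P.evalDouble_ofU]
  have h2 := congrArg r h
  rwa [hr, hr, ← mul_assoc] at h2

lemma IsTwistTensor.comul_right_inv {Y : (U ⊗[k] U)ˣ} (hY : IsTwistTensor Q P φ (Y : U ⊗[k] U)) :
    Algebra.TensorProduct.map (AlgHom.id k U) (comulAlgHom k U) (↑Y⁻¹ : U ⊗[k] U) =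
      leg12 k U U U (twistFirst φ Q.RInv) * leg13 k U U U (↑Y⁻¹ : U ⊗[k] U) *
        leg12 k U U U (flip21 Q.RInv) := by
  have hR : Q.R * Q.RInv = 1 := Q.isUniversal.mul_antipode_left
  have h1 : leg12 k U U U (twistFirst φ Q.R) * leg12 k U U U (twistFirst φ Q.RInv) = 1 := by
    rw [← map_mul, ← map_mul, hR, map_one, map_one]
  have h2 : leg12 k U U U (flip21 Q.R) * leg12 k U U U (flip21 Q.RInv) = 1 := by
    rw [← map_mul, ← flip21_mul, hR, flip21_one, map_one]
  have h3 : leg13 k U U U (Y : U ⊗[k] U) * leg13 k U U U (↑Y⁻¹ : U ⊗[k] U) = 1 := by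
    rw [← map_mul, Units.mul_inv, map_one]
  refine left_inv_eq_right_inv (a := Algebra.TensorProduct.map (AlgHom.id k U) (comulAlgHom k U)
    (Y : U ⊗[k] U)) (by rw [← map_mul, Units.inv_mul, map_one]) ?_
  rw [hY.comul_right]
  calc _ = leg12 k U U U (flip21 Q.R) * (leg13 k U U U (Y : U ⊗[k] U) *
        (leg12 k U U U (twistFirst φ Q.R) * leg12 k U U U (twistFirst φ Q.RInv)) *
        leg13 k U U U (↑Y⁻¹ : U ⊗[k] U)) * leg12 k U U U (flip21 Q.RInv) := by
        simp only [mul_assoc]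
    _ = 1 := by rw [h1, mul_one, h3, mul_one, h2]

lemma IsTwistTensor.inv_mul_comul {Y : (U ⊗[k] U)ˣ} (hY : IsTwistTensor Q P φ (Y : U ⊗[k] U))
    (x : U) : (↑Y⁻¹ : U ⊗[k] U) * comul (R := k) x =
      twistFirst φ (comul (R := k) x) * (↑Y⁻¹ : U ⊗[k] U) := by
  rw [Units.eq_mul_inv_iff_mul_eq, mul_assoc, ← P.mul_twist_comul φ _ hY.invariant, ← mul_assoc,
    Units.inv_mul, one_mul]

end MixedRelation

section Z

variable {k Um Up U F : Type*} [CommRing k]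
  [Ring Um] [HopfAlgebra k Um] [Ring Up] [HopfAlgebra k Up] [Ring U] [HopfAlgebra k U]
  [Ring F] [HopfAlgebra k F] [Module.Free k Um] [Module.Finite k Um]
  [Module.Free k Up] [Module.Finite k Up] (Q : QuantumDouble k Um Up U) (P : HopfDuality k U F)

/-- The endomorphism of `U` attached to `Z` is the projection of `U` onto `Up`. -/
lemma toHom_Z : P.toHom (Z Q P) = Q.proj := by
  ext v
  have h : ∀ X : Up ⊗[k] Module.Dual k Up,
      P.toHom (TensorProduct.map Q.inclPlus.toLinearMap (inclFPlus Q P) X) v =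
      Q.inclPlus (TensorProduct.rid k Up
        (TensorProduct.map LinearMap.id (Module.Dual.eval k Up (Q.projPlus v)) X)) := by
    intro X
    induction X with
    | zero => simp
    | add a b ha hb => simp only [map_add, LinearMap.add_apply, ha, hb]
    | tmul x ℓ =>
      have h1 : P.pair v (inclFPlus Q P ℓ) = ℓ (Q.projPlus v) :=
        LinearMap.congr_fun (P.equivDual.apply_symm_apply (Q.projPlus.dualMap ℓ)) v
      simp [h1]
  rw [Z, h, pair_canonicalElement]
  rfl

/-- `Z` is invertible with inverse `(S ⊗ id)(Z)`. -/
lemma Z_mul_antipode [Module.Free k U] [Module.Finite k U] :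
    Z Q P * TensorProduct.map (antipode k) LinearMap.id (Z Q P) = 1 ∧
      TensorProduct.map (antipode k) LinearMap.id (Z Q P) * Z Q P = 1 :=
  P.mul_antipode_of_comul _ (by rw [toHom_Z]; exact Q.comul_proj)
    (by rw [toHom_Z]; exact Q.counit_proj)

end Z

section Contraction

variable {k U F : Type*} [CommRing k] [Ring U] [HopfAlgebra k U] [Ring F] [HopfAlgebra k F]
  (P : HopfDuality k U F) {φ : U ≃ₐ[k] U} {h : F}

/-- For a twisted cocommutative `h`, the contraction of `φ(X) W X'` with `h`, where `X` and `X'`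
lie in `U ⊗ F` and `W` in `U ⊗ U`, is computed by moving `φ(X)` around the twisted trace. -/
lemma evalDouble_contract (hh : P.IsTwistedCocommutative φ h) (X X' : U ⊗[k] F) (W : U ⊗[k] U)
    (v : U) : P.evalDouble (P.contract h (twistFirst φ (inF P X) * inU P W * inF P X')) v =
      traceContract (P.pair.flip h) (convMul (P.toHom X) (P.toHom X') (comul (R := k) v))
        (Algebra.TensorProduct.map (AlgHom.id k U) (comulAlgHom k U) W) := by
  induction X with
  | zero => simp [convMul_zero_left, traceContract_zero_left]
  | add a b ha hb =>
    simp only [map_add, add_mul, LinearMap.add_apply, convMul_add_left, traceContract_add_left,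
      ha, hb]
  | tmul z ζ =>
    induction X' with
    | zero => simp [convMul_zero_right, traceContract_zero_left]
    | add a b ha hb =>
      simp only [map_add, mul_add, LinearMap.add_apply, convMul_add_right, traceContract_add_left,
        ha, hb]
    | tmul w ω =>
      induction W with
      | zero => simp
      | add a b ha hb => simp only [map_add, mul_add, add_mul, LinearMap.add_apply, ha, hb]
      | tmul y y' =>
        have h1 : P.contract h (twistFirst φ (inF P (z ⊗ₜ[k] ζ)) * inU P (y ⊗ₜ[k] y') *
            inF P (w ⊗ₜ[k] ω)) =
            P.pair (y * w * z) h • (ofF P ζ * (ofU P y' * ofF P ω)) := by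
          rw [hh.pair_mul]
          simp [HopfDuality.contract, twistFirst, inF, inU, mul_assoc]
        rw [h1, map_smul, LinearMap.smul_apply, P.evalDouble_ofF_mul,
          Algebra.TensorProduct.map_tmul, AlgHom.id_apply, comulAlgHom_apply]
        induction comul (R := k) v with
        | zero => simp [traceContract_zero_left]
        | add a b ha hb => simp only [map_add, smul_add, traceContract_add_left, ha, hb]
        | tmul s t =>
          rw [TensorProduct.map_tmul, P.evalDouble_ofU_mul_ofF]
          induction comul (R := k) y' with
          | zero => simp
          | add a b ha hb =>
            simp only [map_add, TensorProduct.tmul_add, smul_add] at ha hb ⊢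
            rw [ha, hb]
          | tmul a b => simp [smul_smul, mul_assoc, mul_comm, mul_left_comm]

end Contraction

end TwistedHeisenberg

theorem mainTheorem3 {k Um Up U F : Type*} [CommRing k]
    [Ring Um] [HopfAlgebra k Um] [Ring Up] [HopfAlgebra k Up]
    [Ring U] [HopfAlgebra k U] [Ring F] [HopfAlgebra k F]
    [Module.Free k Um] [Module.Finite k Um] [Module.Free k Up] [Module.Finite k Up]
    [Module.Free k U] [Module.Finite k U]
    (Q : TwistedHeisenberg.QuantumDouble k Um Up U)
    (P : TwistedHeisenberg.HopfDuality k U F)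
    (φ : U ≃ₐ[k] U)
    (hφ : Algebra.TensorProduct.map (φ : U →ₐ[k] U) (φ : U →ₐ[k] U) Q.R = Q.R)
    (Y : (U ⊗[k] U)ˣ)
    (hY : TwistedHeisenberg.IsTwistTensor Q P φ (Y : U ⊗[k] U))
    (h : F) (hh : P.IsTwistedCocommutative φ h) :
    IsUnit (TwistedHeisenberg.HeisenbergDouble.inF P (TwistedHeisenberg.Z Q P)) ∧
    ∃ u : Uˣ, (↑u⁻¹ : U) = Q.uInv ∧
      (∀ x : U, HopfAlgebra.antipode k (HopfAlgebra.antipode k x) = ↑u * x * ↑u⁻¹) ∧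
      ∃ c : U,
        TwistedHeisenberg.tildeMap Q P φ Y h = TwistedHeisenberg.HeisenbergDouble.ofU P c ∧
        c = P.contract h (((↑u⁻¹ : U) ⊗ₜ[k] (1 : U)) * (↑Y⁻¹ : U ⊗[k] U)) ∧
        ∀ x : U, Commute c x := by
  open TwistedHeisenberg HeisenbergDouble in
  obtain ⟨hZ, hZ'⟩ := Z_mul_antipode Q P
  set Z' := TensorProduct.map (HopfAlgebra.antipode k) LinearMap.id (Z Q P) with hZdef
  let z : (U ⊗[k] HeisenbergDouble P)ˣ :=
    ⟨inF P (Z Q P), inF P Z', by rw [← map_mul, hZ, map_one], by rw [← map_mul, hZ', map_one]⟩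
  have hinv : Ring.inverse (inF P (Z Q P)) = inF P Z' := Ring.inverse_unit z
  refine ⟨z.isUnit, Q.isUniversal.drinfeldUnit, ?_, Q.isUniversal.antipode_antipode, _, ?_, rfl,
    Q.isUniversal.commute_contract φ hφ (P.pair.flip h) hh.pair_mul _ hY.inv_mul_comul⟩
  · change IsUniversalRMatrix.mulAntipodeSq k U Q.R = Q.uInv
    rw [QuantumDouble.uInv]
    generalize Q.R = X
    induction X with
    | zero => simp [flip21]
    | add a b ha hb => simp only [flip21, map_add] at ha hb ⊢; rw [ha, hb]
    | tmul a b => simp [flip21]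
  · -- both sides are compared after contraction with `v ∈ U`, and it suffices to take `v = a x`
    refine P.evalDouble_injective (Q.linearMap_ext fun a x => ?_)
    rw [P.evalDouble_ofU, tildeMap, tildeT, hinv, evalDouble_contract P hh, hY.comul_right_inv,
      P.toHom_map_left, toHom_Z]
    change traceContract _ (Q.convProj _) _ = _
    rw [Q.convProj_comul_mul, traceContract_smul, Q.traceContract_convProj φ hφ _ hh.pair_mul,
      Bialgebra.counit_mul, mul_smul, CoalgHomClass.counit_comp_apply,
      CoalgHomClass.counit_comp_apply]
    rfl
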